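/- **Theorem 2.17.** *Setting.* Let $E$ be a real vector space of dimension $n-1\equiv 6 \pmod 8$ with a negative definite scalar product $\langle\cdot,\cdot\rangle$, let $\mathfrak m=E\oplus\mathbb Rp\oplus\mathbb Rq$ be the Minkowski space in which $p,q$ are isotropic, orthogonal to $E$, and $\langle p,q\rangle=1$, and write $e^\flat=\langle e,\cdot\rangle\in E^*$. Clifford algebras are taken with the convention $v^2=-\langle v,v\rangle$. Let $b$ be a non-degenerate symmetric bilinear form on $E$ and let $B\in\operatorname{End}(E)$ be given by $b(e,f)=-\langle Be,f\rangle$. Let $\mathfrak{heis}_b=E^*\oplus E\oplus\mathbb Rp$ be the Heisenberg Lie algebra whose only non-trivial brackets are $[e^\flat,f]=b(e,f)p$. Let $S_0$ be a real irreducible $\mathrm{Cl}(E)$-module, let $\omega=e_1\cdots e_{n-1}\in \mathrm{Cl}(E)$ be the volume form of an orthonormal basis of $E$, and let $\mathcal C^\circ\subseteq\operatorname{End}_{\mathbb R}(S_0)$ be the even Schur algebra, i.e. the algebra of endomorphisms commuting with Clifford multiplication by all $e\in E$. Let $S=S_-\oplus S_+=S_0\oplus S_0$ be the $\mathrm{Cl}(\mathfrak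 m)$-module with $$\rho_{\rm spin}(p)=\begin{pmatrix}0&2\sqrt2\\0&0\end{pmatrix},\quad \rho_{\rm spin}(q)=\begin{pmatrix}0&0\\-\tfrac1{\sqrt2}&0\end{pmatrix},\quad \rho_{\rm spin}(e)=\begin{pmatrix}-e&0\\0&e\end{pmatrix}\ (e\in E).$$ A representation $\rho:\mathfrak{heis}_b\to\mathfrak{gl}_{\mathbb R}(S)$ is *spin* if $\rho(e^\flat)=\rho_{\rm spin}(\tfrac14[p,Be])$ for all $e\in E$, i.e. $\rho(e^\flat)=\begin{pmatrix}0&\sqrt2\,Be\\0&0\end{pmatrix}$; it has *non-zero charge* if $\rho(p)\ne0$. For maps $\rho_{11},\rho_{22}:E\to\operatorname{End}_{\mathbb R}(S_0)$, a linear map $\rho_{12}:E\to\operatorname{End}_{\mathbb R}(S_0)$ is $(\rho_{11},\rho_{22})$-*suitable* if $(e,f)\mapsto\rho_{11}(e)\rho_{12}(f)-\rho_{12}(f)\rho_{22}(e)$ is symmetric. *Claim.* The algebra $\mathcal C^\circ$ is isomorphic to $\mathbb H$. Fix any isomorphism of real algebras $\mathbb H\cong\mathcal C^\circ$, through which quaternions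 act on $S_0$. Then every non-zero charge spin representation of $\mathfrak{heis}_b$ on $S$ is given by $$\rho(p)=\sqrt2\begin{pmatrix}0&h_1+h_2\omega\\0&0\end{pmatrix},\qquad \rho(e)=\begin{pmatrix}\rho_{11}(e)&\rho_{12}(e)\\0&\rho_{22}(e)\end{pmatrix}\quad(e\in E),$$ $$\rho_{11}(e)=\tfrac12\big(h_3(e)-h_1e+h_2e\,\omega+h_4(e)\omega\big),\qquad \rho_{22}(e)=\tfrac12\big(h_3(e)+h_1e+h_2e\,\omega-h_4(e)\omega\big),$$ where $h_1,h_2\in\mathbb H$, $h_3,h_4\in\operatorname{Hom}_{\mathbb R}(E,\mathbb H)$, $\rho_{12}\in\operatorname{Hom}_{\mathbb R}(E,\operatorname{End}_{\mathbb R}(S_0))$ is $(\rho_{11},\rho_{22})$-suitable, and, for a sign $\pm$, one of the following holds: 1. $\operatorname{Im}h_2\neq0$; the image $\operatorname{Im}h_3(E)\subseteq\operatorname{Im}\mathbb H$ has dimension at most $1$ or equals $(\operatorname{Im}h_2)^\perp$ (the orthogonal complement in $\operatorname{Im}\mathbb H\cong\mathbb R^3$); and $$h_1=\pm\Big(|\operatorname{Im}h_2|-\operatorname{Re}h_2\,\frac{\operatorname{Im}h_2}{|\operatorname{Im}h_2|}\Big),\qquad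 h_4(e)=\pm\frac{\operatorname{Im}h_2\times\operatorname{Im}h_3(e)}{|\operatorname{Im}h_2|};$$ 2. $\operatorname{Re}h_1=0$, $\operatorname{Im}h_1\ne0$; the image $\operatorname{Im}h_3(E)$ has dimension at most $1$ or equals $(\operatorname{Im}h_1)^\perp$; and $$h_2=\pm|\operatorname{Im}h_1|,\qquad h_4(e)=\mp\frac{\operatorname{Im}h_1\times\operatorname{Im}h_3(e)}{|\operatorname{Im}h_1|}.$$ Conversely, for all such data the formulas above define a non-zero charge spin representation of $\mathfrak{heis}_b$ on $S$. -/

import Mathlib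

open scoped Quaternion

attribute [local instance] LieRing.ofAssociativeRing

noncomputable section

namespace SpinHeis

section Spaces

variable (E : Type*) [NormedAddCommGroup E] [InnerProductSpace ℝ E]

/-- The negative definite scalar product `⟨·,·⟩|_E`: minus the inner product of `E`. -/
def pairing : LinearMap.BilinForm ℝ E := -innerₗ E

variable {E} in
@[simp]
theorem pairing_apply (e f : E) : pairing E e f = -inner ℝ e f := rfl

theorem pairing_nondegenerate : (pairing E).Nondegenerate := by
  constructor
  · intro x hx
    have h := hx x
    rw [pairing_apply, neg_eq_zero] at h
    exact inner_self_eq_zero.mp h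
  · intro x hx
    have h := hx x
    rw [pairing_apply, neg_eq_zero] at h
    exact inner_self_eq_zero.mp h

/-- The Minkowski space `𝔪 = E ⊕ ℝp ⊕ ℝq`; `(e, x, y)` stands for `e + x p + y q`. -/
abbrev Mink : Type _ := E × ℝ × ℝ

/-- The scalar product of `𝔪`, of signature `(+, -, …, -)`: it restricts to `pairing E` on `E`,
`p` and `q` are isotropic and orthogonal to `E`, and `⟨p, q⟩ = 1`. -/
def minkPairing : LinearMap.BilinForm ℝ (Mink E) :=
  LinearMap.mk₂ ℝ (fun v w => pairing E v.1 w.1 + v.2.1 * w.2.2 + v.2.2 * w.2.1)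
    (by intros; simp only [Prod.fst_add, Prod.snd_add, map_add, LinearMap.add_apply]; ring)
    (by intros; simp only [Prod.smul_fst, Prod.smul_snd, map_smul, LinearMap.smul_apply,
          smul_eq_mul]; ring)
    (by intros; simp only [Prod.fst_add, Prod.snd_add, map_add]; ring)
    (by intros; simp only [Prod.smul_fst, Prod.smul_snd, map_smul, smul_eq_mul]; ring)

variable {E} in
@[simp]
theorem minkPairing_apply (v w : Mink E) :
    minkPairing E v w = pairing E v.1 w.1 + v.2.1 * w.2.2 + v.2.2 * w.2.1 := rfl

/-- The quadratic form `v ↦ -⟨v, v⟩` on `E`. The sign convention of the Clifford algebras is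
`v² = -⟨v, v⟩`, so the vectors of an orthonormal basis of `E` square to `+1`. -/
def euclForm : QuadraticForm ℝ E := -(pairing E).toQuadraticMap

/-- The quadratic form `v ↦ -⟨v, v⟩` on `𝔪`. -/
def minkForm : QuadraticForm ℝ (Mink E) := -(minkPairing E).toQuadraticMap

/-- `Cl(E) = Cl_{0,n-1}`. -/
abbrev ClE : Type _ := CliffordAlgebra (euclForm E)

/-- `Cl(𝔪) = Cl_{1,n}`. -/
abbrev ClM : Type _ := CliffordAlgebra (minkForm E)

variable {E}

/-- The vector `p` of `𝔪`. -/
def vecP : Mink E := (0, 1, 0)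

/-- The vector `e ∈ E` in `𝔪`. -/
def vecE (e : E) : Mink E := (e, 0, 0)

/-- The image `¼[v, w]` of `v ∧ w = ⟨v,·⟩w - ⟨w,·⟩v ∈ 𝔰𝔬(𝔪)` under the embedding
`𝔰𝔬(𝔪) ↪ Cl(𝔪)`. -/
def wedge (v w : Mink E) : ClM E :=
  (1 / 4 : ℝ) • (CliffordAlgebra.ι (minkForm E) v * CliffordAlgebra.ι (minkForm E) w
    - CliffordAlgebra.ι (minkForm E) w * CliffordAlgebra.ι (minkForm E) v)

/-- The volume form `e₁ ⋯ e_m ∈ Cl(E)` of an orthonormal basis (ordered product). -/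
def volumeForm {m : ℕ} (ε : OrthonormalBasis (Fin m) ℝ E) : ClE E :=
  (List.ofFn fun i => CliffordAlgebra.ι (euclForm E) (ε i)).prod

end Spaces

section Heisenberg

variable {E : Type*} [NormedAddCommGroup E] [InnerProductSpace ℝ E]

/-- The musical isomorphism `e ↦ e^♭ = ⟨e, ·⟩|_E`. -/
def flat [FiniteDimensional ℝ E] : E ≃ₗ[ℝ] Module.Dual ℝ E :=
  (pairing E).toDual (pairing_nondegenerate E)

/-- The endomorphism `B` of `E` defined by `b(e, f) = -⟨B e, f⟩`. -/
def opB [FiniteDimensional ℝ E] (b : LinearMap.BilinForm ℝ E) : E →ₗ[ℝ] E := -(flat.symm.toLinearMap ∘ₗ b)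

theorem opB_spec [FiniteDimensional ℝ E] (b : LinearMap.BilinForm ℝ E) (e f : E) :
    b e f = -pairing E (opB b e) f := by
  have h : flat (opB b e) = -b e := by simp [opB]
  have h' : pairing E (opB b e) f = flat (opB b e) f := rfl
  rw [h', h]
  simp

/-- The underlying space `E^* ⊕ E ⊕ ℝp` of the Heisenberg algebra `𝔥𝔢𝔦𝔰_b`. -/
@[ext]
structure Heis (b : LinearMap.BilinForm ℝ E) where
  /-- the component in `E^*` -/
  dual : Module.Dual ℝ E
  /-- the component in `E` -/
  vec : E
  /-- the coefficient of `p` -/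
  ctr : ℝ

namespace Heis

variable {b : LinearMap.BilinForm ℝ E}

/-- The identification with the product that transports the vector space structure. -/
def equivProd (b : LinearMap.BilinForm ℝ E) : Heis b ≃ Module.Dual ℝ E × E × ℝ where
  toFun x := (x.dual, x.vec, x.ctr)
  invFun x := ⟨x.1, x.2.1, x.2.2⟩
  left_inv _ := rfl
  right_inv _ := rfl

instance : AddCommGroup (Heis b) := (equivProd b).addCommGroup

instance : Module ℝ (Heis b) := (equivProd b).module ℝ

@[simp] theorem dual_add (x y : Heis b) : (x + y).dual = x.dual + y.dual := rfl
@[simp] theorem vec_add (x y : Heis b) : (x + y).vec = x.vec + y.vec := rfl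
@[simp] theorem ctr_add (x y : Heis b) : (x + y).ctr = x.ctr + y.ctr := rfl
@[simp] theorem dual_zero : (0 : Heis b).dual = 0 := rfl
@[simp] theorem vec_zero : (0 : Heis b).vec = 0 := rfl
@[simp] theorem ctr_zero : (0 : Heis b).ctr = 0 := rfl
@[simp] theorem dual_smul (r : ℝ) (x : Heis b) : (r • x).dual = r • x.dual := rfl
@[simp] theorem vec_smul (r : ℝ) (x : Heis b) : (r • x).vec = r • x.vec := rfl
@[simp] theorem ctr_smul (r : ℝ) (x : Heis b) : (r • x).ctr = r * x.ctr := rfl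

variable [FiniteDimensional ℝ E]

/-- The bracket, whose only non-trivial values on the summands are
`[e^♭, f] = b(e, f) p = -[f, e^♭]`. -/
instance : Bracket (Heis b) (Heis b) where
  bracket x y := ⟨0, 0, b (flat.symm x.dual) y.vec - b (flat.symm y.dual) x.vec⟩

@[simp] theorem dual_lie (x y : Heis b) : ⁅x, y⁆.dual = 0 := rfl
@[simp] theorem vec_lie (x y : Heis b) : ⁅x, y⁆.vec = 0 := rfl
@[simp] theorem ctr_lie (x y : Heis b) :
    ⁅x, y⁆.ctr = b (flat.symm x.dual) y.vec - b (flat.symm y.dual) x.vec := rfl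

instance : LieRing (Heis b) where
  add_lie x y z := by
    ext <;> simp
    ring
  lie_add x y z := by
    ext <;> simp
    ring
  lie_self x := by
    ext <;> simp
  leibniz_lie x y z := by
    ext <;> simp

instance : LieAlgebra ℝ (Heis b) where
  lie_smul r x y := by
    ext <;> simp
    ring

/-- The element `e^♭` of `E^* ⊆ 𝔥𝔢𝔦𝔰_b`. -/
def ofFlat (b : LinearMap.BilinForm ℝ E) (e : E) : Heis b := ⟨flat e, 0, 0⟩

/-- The element `e` of `E ⊆ 𝔥𝔢𝔦𝔰_b`. -/
def ofVec (b : LinearMap.BilinForm ℝ E) (e : E) : Heis b := ⟨0, e, 0⟩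

/-- The central element `p` of `𝔥𝔢𝔦𝔰_b`. -/
def p (b : LinearMap.BilinForm ℝ E) : Heis b := ⟨0, 0, 1⟩

end Heis

end Heisenberg

section Spinors

/-- The endomorphism of `S₀ ⊕ S₀ = S₋ ⊕ S₊` with block matrix `(a₁₁ a₁₂; a₂₁ a₂₂)`, acting on
columns `(Q₋, Q₊)`. -/
def block {S₀ : Type*} [AddCommGroup S₀] [Module ℝ S₀] (a₁₁ a₁₂ a₂₁ a₂₂ : Module.End ℝ S₀) :
    Module.End ℝ (S₀ × S₀) :=
  LinearMap.prod (LinearMap.coprod a₁₁ a₁₂) (LinearMap.coprod a₂₁ a₂₂)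

variable {E : Type*} [NormedAddCommGroup E] [InnerProductSpace ℝ E]
variable (S₀ : Type*) [AddCommGroup S₀] [Module ℝ S₀] [Module (ClE E) S₀]
  [IsScalarTower ℝ (ClE E) S₀]

/-- The action `ρ_{0,n-1} : Cl(E) → End_ℝ(S₀)`. -/
def cl : ClE E →ₐ[ℝ] Module.End ℝ S₀ := Algebra.lsmul ℝ ℝ S₀

/-- Clifford multiplication of spinors by vectors of `E`. -/
def clMul : E →ₗ[ℝ] Module.End ℝ S₀ :=
  (cl S₀).toLinearMap ∘ₗ CliffordAlgebra.ι (euclForm E)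

theorem clMul_clMul (e : E) (s : S₀) :
    clMul S₀ e (clMul S₀ e s) = euclForm E e • s := by
  change CliffordAlgebra.ι (euclForm E) e • CliffordAlgebra.ι (euclForm E) e • s = _
  rw [smul_smul, CliffordAlgebra.ι_sq_scalar, algebraMap_smul]

variable (E) in
/-- The even Schur algebra `𝒞°`: the endomorphisms of `S₀` (automatically `𝔰𝔬(E)`-invariant) that
commute with the Clifford multiplication by every vector. -/
def evenSchur : Subalgebra ℝ (Module.End ℝ S₀) :=
  Subalgebra.centralizer ℝ (Set.range (clMul S₀ : E →ₗ[ℝ] Module.End ℝ S₀))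

/-- The action on `S = S_{1,1} ⊗ S₀ = S₋ ⊕ S₊` of the vector `e + x p + y q` of `𝔪`:
`p ↦ (0 2√2; 0 0)`, `q ↦ (0 0; -1/√2 0)`, `e ↦ (-e 0; 0 e)`. -/
def spinVec : Mink E →ₗ[ℝ] Module.End ℝ (S₀ × S₀) where
  toFun v := block (-clMul S₀ v.1) ((2 * √2 * v.2.1) • 1) ((-(1 / √2) * v.2.2) • 1) (clMul S₀ v.1)
  map_add' v w := by
    ext s <;> simp [block, add_smul, mul_add]
    all_goals abel
  map_smul' r v := by
    ext s <;> simp [block, mul_smul, mul_left_comm _ r]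

theorem spinVec_sq (v : Mink E) :
    spinVec S₀ v * spinVec S₀ v = algebraMap ℝ _ (minkForm E v) := by
  have h2 : √2 * (√2)⁻¹ = 1 := mul_inv_cancel₀ (by positivity)
  have hQ : minkForm E v = euclForm E v.1 - 2 * (v.2.1 * v.2.2) := by
    simp [minkForm, euclForm]; ring
  have h3 : (2 * √2 * v.2.1) * (-(1 / √2) * v.2.2) = -(2 * (v.2.1 * v.2.2)) := by
    rw [one_div]; linear_combination (-2 * v.2.1 * v.2.2) * h2
  have h4 : (-(1 / √2) * v.2.2) * (2 * √2 * v.2.1) = -(2 * (v.2.1 * v.2.2)) := by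
    rw [mul_comm, h3]
  refine LinearMap.ext fun s => ?_
  rw [hQ]
  refine Prod.ext ?_ ?_
  · change -(clMul S₀ v.1 (-(clMul S₀ v.1 s.1) + (2 * √2 * v.2.1) • s.2))
        + (2 * √2 * v.2.1) • ((-(1 / √2) * v.2.2) • s.1 + clMul S₀ v.1 s.2)
      = (euclForm E v.1 - 2 * (v.2.1 * v.2.2)) • s.1
    rw [map_add, map_neg, clMul_clMul, map_smul, smul_add, smul_smul, h3, sub_smul, neg_smul]
    abel
  · change (-(1 / √2) * v.2.2) • (-(clMul S₀ v.1 s.1) + (2 * √2 * v.2.1) • s.2)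
        + clMul S₀ v.1 ((-(1 / √2) * v.2.2) • s.1 + clMul S₀ v.1 s.2)
      = (euclForm E v.1 - 2 * (v.2.1 * v.2.2)) • s.2
    rw [map_add, map_smul, clMul_clMul, smul_add, smul_smul, h4, sub_smul, neg_smul, smul_neg]
    abel

/-- The spin representation `ρ_spin : Cl(𝔪) → End_ℝ(S)` on `S = S_{1,1} ⊗ S₀ = S₋ ⊕ S₊`. -/
def rhoSpin : ClM E →ₐ[ℝ] Module.End ℝ (S₀ × S₀) :=
  CliffordAlgebra.lift (minkForm E) ⟨spinVec S₀, spinVec_sq S₀⟩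

variable {S₀}
variable [FiniteDimensional ℝ E]

/-- A representation `ρ` of `𝔥𝔢𝔦𝔰_b` on `S` is spin if its restriction to `E^*` is `ρ_spin ∘ 𝔦_b`,
where `𝔦_b(e^♭) = p ∧ B e` is the isotropy representation. -/
def IsSpin {b : LinearMap.BilinForm ℝ E} (ρ : Heis b →ₗ⁅ℝ⁆ Module.End ℝ (S₀ × S₀)) : Prop :=
  ∀ e : E, ρ (Heis.ofFlat b e) = rhoSpin S₀ (wedge vecP (vecE (opB b e)))

end Spinors

section Suitable

/-- `ρ₁₂` is `(ρ₁₁, ρ₂₂)`-suitable: the bilinear map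
`(e, f) ↦ ρ₁₁(e) ρ₁₂(f) - ρ₁₂(f) ρ₂₂(e)` is symmetric. -/
def Suitable {E S₀ : Type*} [AddCommGroup E] [Module ℝ E] [AddCommGroup S₀] [Module ℝ S₀]
    (ρ₁₁ ρ₂₂ : E → Module.End ℝ S₀) (ρ₁₂ : E →ₗ[ℝ] Module.End ℝ S₀) : Prop :=
  ∀ e f : E, ρ₁₁ e * ρ₁₂ f - ρ₁₂ f * ρ₂₂ e = ρ₁₁ f * ρ₁₂ e - ρ₁₂ e * ρ₂₂ f

end Suitable

section Quaternions

/-- The cross product `Im a × Im b`, as an imaginary quaternion. -/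
def imCross (a b : ℍ[ℝ]) : ℍ[ℝ] :=
  ⟨0, a.imJ * b.imK - a.imK * b.imJ, a.imK * b.imI - a.imI * b.imK,
    a.imI * b.imJ - a.imJ * b.imI⟩

/-- The map `h ↦ Im h`. -/
def imLin : ℍ[ℝ] →ₗ[ℝ] ℍ[ℝ] where
  toFun h := h.im
  map_add' _ _ := by simp
  map_smul' _ _ := by simp

/-- The orthogonal complement of `Im h` in `Im ℍ ≅ ℝ³`. -/
def imPerp (h : ℍ[ℝ]) : Submodule ℝ ℍ[ℝ] where
  carrier := {v | v.re = 0 ∧ inner ℝ h.im v = 0}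
  zero_mem' := by simp
  add_mem' := by
    rintro v w ⟨hv, hv'⟩ ⟨hw, hw'⟩
    exact ⟨by simp [hv, hw], by rw [inner_add_right, hv', hw', add_zero]⟩
  smul_mem' := by
    rintro r v ⟨hv, hv'⟩
    exact ⟨by simp [hv], by rw [inner_smul_right, hv', mul_zero]⟩

variable {E : Type*} [AddCommGroup E] [Module ℝ E]

/-- The condition on `Im h₃ : E → Im ℍ` relative to a quaternion `h`: either `Im h₃` has rank at
most `1` or its image is `(Im h)^⊥`. -/
def ImCondition (h : ℍ[ℝ]) (h₃ : E →ₗ[ℝ] ℍ[ℝ]) : Prop :=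
  Module.finrank ℝ (LinearMap.range (imLin ∘ₗ h₃)) ≤ 1 ∨ LinearMap.range (imLin ∘ₗ h₃) = imPerp h

/-- The first family of parameters, with sign `s = ±1`. -/
def FirstFamily (s : ℝ) (h₁ h₂ : ℍ[ℝ]) (h₃ h₄ : E →ₗ[ℝ] ℍ[ℝ]) : Prop :=
  h₂.im ≠ 0 ∧ ImCondition h₂ h₃ ∧
  h₁ = s • ((‖h₂.im‖ : ℍ[ℝ]) - (h₂.re / ‖h₂.im‖) • h₂.im) ∧
  ∀ e, h₄ e = (s / ‖h₂.im‖) • imCross h₂ (h₃ e)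

/-- The second family of parameters, with sign `s = ±1`. -/
def SecondFamily (s : ℝ) (h₁ h₂ : ℍ[ℝ]) (h₃ h₄ : E →ₗ[ℝ] ℍ[ℝ]) : Prop :=
  h₁.re = 0 ∧ h₁.im ≠ 0 ∧ ImCondition h₁ h₃ ∧
  h₂ = s • (‖h₁.im‖ : ℍ[ℝ]) ∧
  ∀ e, h₄ e = (-s / ‖h₁.im‖) • imCross h₁ (h₃ e)

/-- The parameters of the non-zero charge representations: one of the two families. -/
def IsParameter (h₁ h₂ : ℍ[ℝ]) (h₃ h₄ : E →ₗ[ℝ] ℍ[ℝ]) : Prop :=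
  ∃ s : ℝ, (s = 1 ∨ s = -1) ∧ (FirstFamily s h₁ h₂ h₃ h₄ ∨ SecondFamily s h₁ h₂ h₃ h₄)

end Quaternions

section Formulas

variable {E : Type*} [NormedAddCommGroup E] [InnerProductSpace ℝ E]
variable {S₀ : Type*} [AddCommGroup S₀] [Module ℝ S₀] [Module (ClE E) S₀]
  [IsScalarTower ℝ (ClE E) S₀]

/-- The action of quaternions on `S₀` through an identification `Φ : ℍ ≅ 𝒞°`. -/
def qAct (Φ : ℍ[ℝ] ≃ₐ[ℝ] evenSchur E S₀) : ℍ[ℝ] →ₐ[ℝ] Module.End ℝ S₀ :=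
  (evenSchur E S₀).val.comp Φ.toAlgHom

/-- `ρ₁₁(e) = ½ (h₃(e) Id - h₁ e + h₂ e ω + h₄(e) ω)`, where quaternions act through
`Φ : ℍ ≅ 𝒞°`. -/
def rho11 (Φ : ℍ[ℝ] ≃ₐ[ℝ] evenSchur E S₀) (ω : ClE E) (h₁ h₂ : ℍ[ℝ]) (h₃ h₄ : E →ₗ[ℝ] ℍ[ℝ])
    (e : E) : Module.End ℝ S₀ :=
  (1 / 2 : ℝ) • (qAct Φ (h₃ e) - qAct Φ h₁ * clMul S₀ e
    + qAct Φ h₂ * clMul S₀ e * cl S₀ ω + qAct Φ (h₄ e) * cl S₀ ω)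

/-- `ρ₂₂(e) = ½ (h₃(e) Id + h₁ e + h₂ e ω - h₄(e) ω)`. -/
def rho22 (Φ : ℍ[ℝ] ≃ₐ[ℝ] evenSchur E S₀) (ω : ClE E) (h₁ h₂ : ℍ[ℝ]) (h₃ h₄ : E →ₗ[ℝ] ℍ[ℝ])
    (e : E) : Module.End ℝ S₀ :=
  (1 / 2 : ℝ) • (qAct Φ (h₃ e) + qAct Φ h₁ * clMul S₀ e
    + qAct Φ h₂ * clMul S₀ e * cl S₀ ω - qAct Φ (h₄ e) * cl S₀ ω)

/-- `ρ(p) = √2 (0 h₁ Id + h₂ ω; 0 0)` and `ρ(e) = (ρ₁₁(e) ρ₁₂(e); 0 ρ₂₂(e))`. -/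
def IsGivenBy [FiniteDimensional ℝ E] {b : LinearMap.BilinForm ℝ E}
    (ρ : Heis b →ₗ⁅ℝ⁆ Module.End ℝ (S₀ × S₀)) (Φ : ℍ[ℝ] ≃ₐ[ℝ] evenSchur E S₀) (ω : ClE E)
    (h₁ h₂ : ℍ[ℝ]) (h₃ h₄ : E →ₗ[ℝ] ℍ[ℝ]) (ρ₁₂ : E →ₗ[ℝ] Module.End ℝ S₀) : Prop :=
  ρ (Heis.p b) = √2 • block 0 (qAct Φ h₁ + qAct Φ h₂ * cl S₀ ω) 0 0 ∧
  ∀ e : E, ρ (Heis.ofVec b e) =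
    block (rho11 Φ ω h₁ h₂ h₃ h₄ e) (ρ₁₂ e) 0 (rho22 Φ ω h₁ h₂ h₃ h₄ e)

end Formulas

end SpinHeis

end

/-!
Averaging an inner product over the group generated by an orthonormal basis makes the basis act on
`S₀` by symmetric anticommuting involutions. Irreducibility then forces the symmetric elements of
the commutant `𝒞°` to be scalars, while the trace of the averaging projection, and that of its
composition with transposition, count the dimensions of `𝒞°` and of its symmetric part. In
dimension `6` modulo `8` these give `dim 𝒞° = 4`, and two anticommuting skew elements of `𝒞°`
make it `ℍ`.

For a spin representation with diagonal blocks `ρ₁₁`, `ρ₂₂`, the brackets with `E*` say that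
`e ρ₂₂(f) - ρ₁₁(f) e` is a multiple `⟪e, f⟫ Z` of a fixed endomorphism. Conjugating by vectors
solves this and yields the block formulas with coefficients `a + b ω`, where `a, b ∈ ℍ` and
`ω² = -1`. The other brackets become equations in `ℍ ⊗ ℂ`, beginning with `h₁² + h₂² = 0` and
`[h₁, h₂] = 0`. So `u = -h₁ h₂⁻¹` is an imaginary unit with `h₂ = x + t u`, `h₁ = -u h₂` and
`h₄ = u × Im h₃`; the two families of the theorem are `t ≠ 0` and `t = 0`.
-/

noncomputable section

namespace SpinHeis

open scoped Matrix

section CliffordFamilies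

variable {R ι : Type*} [Ring R]

/-- A family of pairwise anticommuting square roots of `1`: the images of the vectors of an
orthonormal basis under a Clifford multiplication. -/
structure IsCliffordFamily (γ : ι → R) : Prop where
  sq : ∀ i, γ i * γ i = 1
  anticomm : ∀ i j, i ≠ j → γ i * γ j = -(γ j * γ i)

/-- The ordered product of the members of a family along a list of indices. -/
def monomial (γ : ι → R) (L : List ι) : R := (L.map γ).prod

@[simp]
theorem monomial_nil (γ : ι → R) : monomial γ [] = 1 := rfl

@[simp]
theorem monomial_cons (γ : ι → R) (j : ι) (L : List ι) :
    monomial γ (j :: L) = γ j * monomial γ L := by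
  simp [monomial]

theorem monomial_append (γ : ι → R) (K L : List ι) :
    monomial γ (K ++ L) = monomial γ K * monomial γ L := by
  simp [monomial]

namespace IsCliffordFamily

variable {γ : ι → R}

theorem commute_of_conj_eq (hγ : IsCliffordFamily γ) {i : ι} {x : R} (h : γ i * x * γ i = x) :
    γ i * x = x * γ i := by
  calc γ i * x = γ i * (γ i * x * γ i) := by rw [h]
    _ = (γ i * γ i) * x * γ i := by noncomm_ring
    _ = x * γ i := by rw [hγ.sq, one_mul]

theorem conj_eq_of_commute (hγ : IsCliffordFamily γ) {i : ι} {x : R} (h : γ i * x = x * γ i) :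
    γ i * x * γ i = x := by
  rw [h, mul_assoc, hγ.sq, mul_one]

theorem conj_conj_self (hγ : IsCliffordFamily γ) (i : ι) (x : R) :
    γ i * (γ i * x * γ i) * γ i = x := by
  calc γ i * (γ i * x * γ i) * γ i = (γ i * γ i) * x * (γ i * γ i) := by noncomm_ring
    _ = x := by rw [hγ.sq, one_mul, mul_one]

theorem conj_conj_comm (hγ : IsCliffordFamily γ) (i j : ι) (x : R) :
    γ i * (γ j * x * γ j) * γ i = γ j * (γ i * x * γ i) * γ j := by
  rcases eq_or_ne i j with rfl | h
  · rfl
  · calc γ i * (γ j * x * γ j) * γ i = (γ i * γ j) * x * (γ j * γ i) := by noncomm_ring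
      _ = (γ j * γ i) * x * (γ i * γ j) := by
        rw [hγ.anticomm i j h, hγ.anticomm j i h.symm]
        noncomm_ring
      _ = γ j * (γ i * x * γ i) * γ j := by noncomm_ring

variable [Algebra ℝ R]

theorem mul_monomial_of_notMem (hγ : IsCliffordFamily γ) {j : ι} {L : List ι} (h : j ∉ L) :
    γ j * monomial γ L = (-1 : ℝ) ^ L.length • (monomial γ L * γ j) := by
  induction L with
  | nil => simp
  | cons i L ih =>
    rw [List.mem_cons, not_or] at h
    rw [monomial_cons, ← mul_assoc, hγ.anticomm j i h.1, neg_mul, mul_assoc, ih h.2,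
      List.length_cons, pow_succ, mul_smul_comm, mul_assoc, mul_neg_one, neg_smul]

theorem monomial_mul_of_notMem (hγ : IsCliffordFamily γ) {j : ι} {L : List ι} (h : j ∉ L) :
    monomial γ L * γ j = (-1 : ℝ) ^ L.length • (γ j * monomial γ L) := by
  rw [hγ.mul_monomial_of_notMem h, smul_smul, ← mul_pow, neg_one_mul, neg_neg, one_pow, one_smul]

theorem mul_monomial_of_mem (hγ : IsCliffordFamily γ) {j : ι} {L : List ι} (hL : L.Nodup)
    (h : j ∈ L) :
    γ j * monomial γ L = (-1 : ℝ) ^ (L.length + 1) • (monomial γ L * γ j) := by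
  induction L with
  | nil => simp at h
  | cons i L ih =>
    rw [List.nodup_cons] at hL
    rw [monomial_cons, List.length_cons]
    by_cases hij : j = i
    · subst hij
      rw [mul_assoc, hγ.monomial_mul_of_notMem hL.1, mul_smul_comm, smul_smul, ← pow_add,
        Even.neg_one_pow, one_smul]
      exact ⟨L.length + 1, by ring⟩
    · have hjL : j ∈ L := (List.mem_cons.mp h).resolve_left hij
      rw [← mul_assoc, hγ.anticomm j i hij, neg_mul, mul_assoc, ih hL.2 hjL,
        pow_succ _ (L.length + 1), mul_smul_comm, mul_assoc, mul_neg_one, neg_smul]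

theorem monomial_mul_self (hγ : IsCliffordFamily γ) {L : List ι} (hL : L.Nodup) :
    monomial γ L * monomial γ L = (-1 : ℝ) ^ (L.length.choose 2) • 1 := by
  induction L with
  | nil => simp
  | cons i L ih =>
    rw [List.nodup_cons] at hL
    calc monomial γ (i :: L) * monomial γ (i :: L)
        = γ i * (monomial γ L * γ i) * monomial γ L := by simp [mul_assoc]
      _ = (-1 : ℝ) ^ L.length • ((γ i * γ i) * (monomial γ L * monomial γ L)) := by
        rw [hγ.monomial_mul_of_notMem hL.1]
        simp [mul_assoc]
      _ = _ := by
        rw [hγ.sq, ih hL.2, one_mul, smul_smul, ← pow_add, List.length_cons,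
          Nat.choose_succ_succ' L.length 1, Nat.choose_one_right]

end IsCliffordFamily

end CliffordFamilies

section ConjugationAverages

variable {R ι : Type*} [Ring R] [Algebra ℝ R]

/-- The composition, over the indices `j` of a list, of the averages of `x` and its conjugate
`γ j * x * γ j`. For a Clifford family it projects onto the centralizer of the listed members. -/
def conjAverage (γ : ι → R) : List ι → (R →ₗ[ℝ] R)
  | [] => LinearMap.id
  | j :: L =>
    (1 / 2 : ℝ) • (conjAverage γ L + LinearMap.mulLeftRight ℝ (γ j, γ j) ∘ₗ conjAverage γ L)

theorem conjAverage_cons_apply (γ : ι → R) (j : ι) (L : List ι) (x : R) :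
    conjAverage γ (j :: L) x
      = (1 / 2 : ℝ) • (conjAverage γ L x + γ j * conjAverage γ L x * γ j) := by
  simp [conjAverage]

theorem conjAverage_eq_sum (γ : ι → R) (L : List ι) :
    conjAverage γ L = (1 / 2 : ℝ) ^ L.length • (L.sublists'.map fun K =>
      LinearMap.mulLeftRight ℝ (monomial γ K, monomial γ K.reverse)).sum := by
  induction L with
  | nil => ext; simp [conjAverage]
  | cons j L ih =>
    have hcomp (K : List ι) : LinearMap.mulLeftRight ℝ (γ j, γ j) ∘ₗ
        LinearMap.mulLeftRight ℝ (monomial γ K, monomial γ K.reverse) =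
        LinearMap.mulLeftRight ℝ (monomial γ (j :: K), monomial γ (j :: K).reverse) := by
      ext x
      simp [monomial_append, mul_assoc]
    have hsum (M : List (R →ₗ[ℝ] R)) : LinearMap.mulLeftRight ℝ (γ j, γ j) ∘ₗ M.sum =
        (M.map (LinearMap.mulLeftRight ℝ (γ j, γ j) ∘ₗ ·)).sum :=
      map_list_sum (LinearMap.llcomp ℝ R R R (LinearMap.mulLeftRight ℝ (γ j, γ j))) M
    rw [conjAverage, ih, LinearMap.comp_smul, ← smul_add, smul_smul, ← pow_succ',
      List.sublists'_cons, List.map_append, List.sum_append, List.length_cons, hsum, List.map_map,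
      List.map_map]
    simp only [Function.comp_def, hcomp]

namespace IsCliffordFamily

variable {γ : ι → R}

theorem conjAverage_eq_self (hγ : IsCliffordFamily γ) {L : List ι} {x : R}
    (h : ∀ i ∈ L, γ i * x = x * γ i) : conjAverage γ L x = x := by
  induction L with
  | nil => rfl
  | cons j L ih =>
    rw [conjAverage_cons_apply, ih fun i hi => h i (List.mem_cons_of_mem _ hi),
      hγ.conj_eq_of_commute (h j List.mem_cons_self)]
    module

theorem conj_conjAverage (hγ : IsCliffordFamily γ) {L : List ι} {i : ι} (hi : i ∈ L) (x : R) :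
    γ i * conjAverage γ L x * γ i = conjAverage γ L x := by
  induction L with
  | nil => simp at hi
  | cons j L ih =>
    rw [conjAverage_cons_apply, mul_smul_comm, smul_mul_assoc, mul_add, add_mul]
    rcases List.mem_cons.mp hi with rfl | hi
    · rw [hγ.conj_conj_self, add_comm]
    · rw [hγ.conj_conj_comm, ih hi]

theorem isProj_conjAverage {m : ℕ} {γ : Fin m → R} (hγ : IsCliffordFamily γ) :
    LinearMap.IsProj (Subalgebra.toSubmodule (Subalgebra.centralizer ℝ (Set.range γ)))
      (conjAverage γ (List.finRange m)) where
  map_mem x := by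
    simpa [Subalgebra.mem_centralizer_iff] using fun i =>
      hγ.commute_of_conj_eq (hγ.conj_conjAverage (List.mem_finRange i) x)
  map_id x hx := hγ.conjAverage_eq_self fun i _ => hx (γ i) (Set.mem_range_self i)

end IsCliffordFamily

end ConjugationAverages

section SignSums

theorem neg_one_pow_choose_two_add_two (k : ℕ) :
    (-1 : ℝ) ^ ((k + 2).choose 2) = -(-1) ^ (k.choose 2) := by
  rw [Nat.choose_succ_succ' (k + 1) 1, Nat.choose_succ_succ' k 1, Nat.choose_one_right,
    Nat.choose_one_right, show k + 1 + (k + k.choose 2) = 2 * k + (k.choose 2 + 1) by ring,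
    pow_add, pow_mul, neg_one_sq, one_pow, one_mul, pow_succ, mul_neg_one]

variable {α : Type*} {f : ℕ → ℝ}

theorem sum_sublists_eq_apply_nil (g : List α → ℝ) (L : List α)
    (hg : ∀ K, K.Sublist L → K ≠ [] → g K = 0) : (L.sublists'.map g).sum = g [] := by
  induction L with
  | nil => simp
  | cons a L ih =>
    have hcons : (L.sublists'.map (g ∘ List.cons a)).sum = 0 := by
      refine List.sum_eq_zero fun x hx => ?_
      obtain ⟨K, hK, rfl⟩ := List.mem_map.mp hx
      exact hg _ ((List.mem_sublists'.mp hK).cons_cons a) (List.cons_ne_nil a K)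
    rw [List.sublists'_cons, List.map_append, List.sum_append, List.map_map,
      ih fun K hK => hg K (hK.cons a), hcons, add_zero]

theorem sum_sublists_cons_cons (hf : ∀ k, f (k + 2) = -f k) (a b : α) (L : List α) :
    ((a :: b :: L).sublists'.map fun K => f K.length).sum
      = 2 * (L.sublists'.map fun K => f (K.length + 1)).sum := by
  simp only [List.sublists'_cons, List.map_append, List.sum_append, List.map_map,
    Function.comp_def, List.length_cons, add_assoc, Nat.reduceAdd, hf]
  simp only [← List.sum_map_add, ← List.sum_map_mul_left]
  congr 2
  ext K
  ring

theorem sum_sublists_cons_cons_cons_cons (hf : ∀ k, f (k + 2) = -f k) (a b c d : α)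
    (L : List α) :
    ((a :: b :: c :: d :: L).sublists'.map fun K => f K.length).sum
      = -4 * (L.sublists'.map fun K => f K.length).sum := by
  rw [sum_sublists_cons_cons hf,
    sum_sublists_cons_cons (f := fun k => f (k + 1)) fun k => hf (k + 1)]
  simp only [add_assoc, Nat.reduceAdd, hf, ← List.sum_map_mul_left]
  congr 2
  ext K
  ring

-- For `f k = Re (z * I ^ k)` the sum over the sublists of a list of length `m` is
-- `Re (z * (1 + I) ^ m)`, and `(1 + I) ^ (8 * t + 6) = -8 * 16 ^ t * I`.
theorem sum_sublists_of_length (hf : ∀ k, f (k + 2) = -f k) (t : ℕ) (L : List α)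
    (hL : L.length = 8 * t + 6) :
    (L.sublists'.map fun K => f K.length).sum = -8 * 16 ^ t * f 1 := by
  induction t generalizing L with
  | zero =>
    match L, hL with
    | [a, b, c, d, e, g], _ =>
      rw [sum_sublists_cons_cons_cons_cons hf, sum_sublists_cons_cons hf]
      simp only [List.sublists'_nil, List.map_cons, List.map_nil, List.sum_cons, List.sum_nil,
        List.length_nil]
      ring
  | succ t ih =>
    match L, hL with
    | a :: b :: c :: d :: e :: f :: g :: h :: L, hL =>
      rw [sum_sublists_cons_cons_cons_cons hf, sum_sublists_cons_cons_cons_cons hf,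
        ih L (by simp only [List.length_cons] at hL; omega)]
      ring

end SignSums

section MatrixTraces

variable {n : Type*} [Fintype n]

theorem trace_eq_sum_apply_single [DecidableEq n] (T : Matrix n n ℝ →ₗ[ℝ] Matrix n n ℝ) :
    LinearMap.trace ℝ _ T = ∑ i, ∑ j, T (Matrix.single i j 1) i j := by
  rw [LinearMap.trace_eq_matrix_trace ℝ (Matrix.stdBasis ℝ n n), Matrix.trace,
    Fintype.sum_prod_type]
  refine Finset.sum_congr rfl fun i _ => Finset.sum_congr rfl fun j _ => ?_
  rw [Matrix.diag_apply, LinearMap.toMatrix_apply, Matrix.stdBasis_eq_single]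
  simp [Matrix.stdBasis]

theorem trace_mulLeftRight (A B : Matrix n n ℝ) :
    LinearMap.trace ℝ _ (LinearMap.mulLeftRight ℝ (A, B)) = A.trace * B.trace := by
  classical
  rw [trace_eq_sum_apply_single, Matrix.trace, Matrix.trace, Finset.sum_mul_sum]
  simp [Matrix.mul_apply, Matrix.single_apply, ite_and]

theorem trace_mulLeftRight_comp_transpose (A B : Matrix n n ℝ) :
    LinearMap.trace ℝ _ (LinearMap.mulLeftRight ℝ (A, B) ∘ₗ
      (Matrix.transposeLinearEquiv n n ℝ ℝ).toLinearMap) = (A * Bᵀ).trace := by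
  classical
  rw [trace_eq_sum_apply_single, Matrix.trace]
  simp [Matrix.mul_apply, Matrix.single_apply, ite_and]

end MatrixTraces

section SymmetricCliffordFamilies

variable {n : Type*} [Fintype n] [DecidableEq n] {m : ℕ} {γ : Fin m → Matrix n n ℝ}

namespace IsCliffordFamily

theorem exists_anticommute_monomial (hγ : IsCliffordFamily γ) (hm : Even m) {K : List (Fin m)}
    (hK : K.Nodup) (hne : K ≠ []) : ∃ j, γ j * monomial γ K = -(monomial γ K * γ j) := by
  rcases Nat.even_or_odd K.length with heven | hodd
  · obtain ⟨j, hj⟩ := List.exists_mem_of_ne_nil K hne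
    exact ⟨j, by rw [hγ.mul_monomial_of_mem hK hj, heven.add_one.neg_one_pow, neg_one_smul]⟩
  · obtain ⟨j, hj⟩ : ∃ j, j ∉ K := by
      by_contra! hall
      refine Nat.not_even_iff_odd.mpr hodd ?_
      rwa [← List.toFinset_card_of_nodup hK, show K.toFinset = Finset.univ by ext j; simp [hall j],
        Finset.card_fin]
    exact ⟨j, by rw [hγ.mul_monomial_of_notMem hj, hodd.neg_one_pow, neg_one_smul]⟩

theorem trace_monomial (hγ : IsCliffordFamily γ) (hm : Even m) {K : List (Fin m)} (hK : K.Nodup)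
    (hne : K ≠ []) : (monomial γ K).trace = 0 := by
  obtain ⟨j, hj⟩ := hγ.exists_anticommute_monomial hm hK hne
  refine self_eq_neg.mp ?_
  calc (monomial γ K).trace = (γ j * (γ j * monomial γ K)).trace := by
        rw [← mul_assoc, hγ.sq, one_mul]
    _ = -(γ j * (monomial γ K * γ j)).trace := by rw [hj, mul_neg, Matrix.trace_neg]
    _ = -(monomial γ K).trace := by rw [Matrix.trace_mul_comm, mul_assoc, hγ.sq, mul_one]

theorem trace_conjAverage (hγ : IsCliffordFamily γ) (hm : Even m) :
    LinearMap.trace ℝ _ (conjAverage γ (List.finRange m))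
      = (1 / 2 : ℝ) ^ m * (Fintype.card n : ℝ) ^ 2 := by
  rw [conjAverage_eq_sum, map_smul, smul_eq_mul, List.length_finRange, map_list_sum, List.map_map,
    sum_sublists_eq_apply_nil]
  · simp [trace_mulLeftRight, pow_two]
  · intro K hK hne
    rw [Function.comp_apply, trace_mulLeftRight,
      hγ.trace_monomial hm (hK.nodup (List.nodup_finRange m)) hne, zero_mul]

end IsCliffordFamily

theorem transpose_monomial (hs : ∀ i, (γ i).IsSymm) (K : List (Fin m)) :
    (monomial γ K)ᵀ = monomial γ K.reverse := by
  induction K with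
  | nil => simp
  | cons j K ih =>
    rw [monomial_cons, Matrix.transpose_mul, ih, hs j, List.reverse_cons, monomial_append,
      monomial_cons, monomial_nil, mul_one]

theorem transpose_conjAverage (hs : ∀ i, (γ i).IsSymm) (L : List (Fin m)) (X : Matrix n n ℝ) :
    (conjAverage γ L X)ᵀ = conjAverage γ L Xᵀ := by
  induction L with
  | nil => rfl
  | cons j L ih =>
    rw [conjAverage_cons_apply, conjAverage_cons_apply, Matrix.transpose_smul,
      Matrix.transpose_add, Matrix.transpose_mul, Matrix.transpose_mul, ih, hs j, mul_assoc]

namespace IsCliffordFamily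

theorem trace_conjAverage_comp_transpose (hγ : IsCliffordFamily γ) (hs : ∀ i, (γ i).IsSymm)
    {t : ℕ} (ht : m = 8 * t + 6) :
    LinearMap.trace ℝ _ (conjAverage γ (List.finRange m) ∘ₗ
        (Matrix.transposeLinearEquiv n n ℝ ℝ).toLinearMap)
      = (1 / 2 : ℝ) ^ m * (-8 * 16 ^ t * Fintype.card n) := by
  have hterm : ∀ K ∈ (List.finRange m).sublists', LinearMap.trace ℝ _
      (LinearMap.mulLeftRight ℝ (monomial γ K, monomial γ K.reverse) ∘ₗ
        (Matrix.transposeLinearEquiv n n ℝ ℝ).toLinearMap)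
        = (-1) ^ (K.length.choose 2) * (Fintype.card n : ℝ) := fun K hK => by
    rw [trace_mulLeftRight_comp_transpose, transpose_monomial hs, List.reverse_reverse,
      hγ.monomial_mul_self ((List.mem_sublists'.mp hK).nodup (List.nodup_finRange m)),
      Matrix.trace_smul, Matrix.trace_one, smul_eq_mul]
  have hsum (M : List (Matrix n n ℝ →ₗ[ℝ] Matrix n n ℝ)) :
      M.sum ∘ₗ (Matrix.transposeLinearEquiv n n ℝ ℝ).toLinearMap =
        (M.map (· ∘ₗ (Matrix.transposeLinearEquiv n n ℝ ℝ).toLinearMap)).sum :=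
    map_list_sum (LinearMap.lcomp ℝ _ (Matrix.transposeLinearEquiv n n ℝ ℝ).toLinearMap) M
  rw [conjAverage_eq_sum, LinearMap.smul_comp, hsum, map_smul, smul_eq_mul, List.length_finRange,
    map_list_sum, List.map_map, List.map_map]
  simp only [Function.comp_def]
  rw [List.map_congr_left hterm, List.sum_map_mul_right,
    sum_sublists_of_length (f := fun k => (-1) ^ k.choose 2) neg_one_pow_choose_two_add_two t _
      (by rw [List.length_finRange, ht])]
  simp

theorem finrank_centralizer (hγ : IsCliffordFamily γ) (hm : Even m) :
    (Module.finrank ℝ (Subalgebra.centralizer ℝ (Set.range γ)) : ℝ)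
      = (1 / 2 : ℝ) ^ m * (Fintype.card n : ℝ) ^ 2 := by
  rw [← hγ.trace_conjAverage hm, hγ.isProj_conjAverage.trace]
  rfl

theorem isProj_symmetrized_conjAverage (hγ : IsCliffordFamily γ) (hs : ∀ i, (γ i).IsSymm)
    (hirr : ∀ X : Matrix n n ℝ, X.IsSymm → (∀ i, γ i * X = X * γ i) → ∃ r : ℝ, X = r • 1) :
    LinearMap.IsProj (Submodule.span ℝ {(1 : Matrix n n ℝ)})
      ((1 / 2 : ℝ) • (conjAverage γ (List.finRange m) + conjAverage γ (List.finRange m) ∘ₗ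
        (Matrix.transposeLinearEquiv n n ℝ ℝ).toLinearMap)) where
  map_mem X := by
    have hcomm (Y : Matrix n n ℝ) (i : Fin m) :
        γ i * conjAverage γ (List.finRange m) Y = conjAverage γ (List.finRange m) Y * γ i :=
      hγ.commute_of_conj_eq (hγ.conj_conjAverage (List.mem_finRange i) Y)
    obtain ⟨r, hr⟩ := hirr ((1 / 2 : ℝ) • (conjAverage γ (List.finRange m) X
        + conjAverage γ (List.finRange m) Xᵀ))
      (by simp [Matrix.IsSymm, transpose_conjAverage hs, add_comm])
      (fun i => by simp only [mul_smul_comm, smul_mul_assoc, mul_add, add_mul, hcomm])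
    exact Submodule.mem_span_singleton.mpr ⟨r, hr.symm⟩
  map_id X hX := by
    obtain ⟨r, rfl⟩ := Submodule.mem_span_singleton.mp hX
    have hone : conjAverage γ (List.finRange m) 1 = 1 := hγ.conjAverage_eq_self fun i _ => by simp
    have htr : (Matrix.transposeLinearEquiv n n ℝ ℝ).toLinearMap 1 = 1 := Matrix.transpose_one
    simp only [LinearMap.smul_apply, LinearMap.add_apply, LinearMap.comp_apply, map_smul, hone, htr]
    module

/-- For matrices of size `N`, the trace of the projection onto the scalars shows that
`u = N / 2 ^ (m / 2)` satisfies `u ^ 2 - u = 2`. So `u = 2`, and the centralizer has dimension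
`u ^ 2`. -/
theorem finrank_centralizer_eq_four [Nonempty n] (hγ : IsCliffordFamily γ)
    (hs : ∀ i, (γ i).IsSymm) {t : ℕ} (ht : m = 8 * t + 6)
    (hirr : ∀ X : Matrix n n ℝ, X.IsSymm → (∀ i, γ i * X = X * γ i) → ∃ r : ℝ, X = r • 1) :
    Module.finrank ℝ (Subalgebra.centralizer ℝ (Set.range γ)) = 4 := by
  have hm : Even m := ⟨4 * t + 3, by omega⟩
  have htrace := (hγ.isProj_symmetrized_conjAverage hs hirr).trace
  rw [map_smul, map_add, hγ.trace_conjAverage hm, hγ.trace_conjAverage_comp_transpose hs ht,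
    finrank_span_singleton one_ne_zero, Nat.cast_one, smul_eq_mul] at htrace
  have hpow : (1 / 2 : ℝ) ^ m = (1 / (8 * 16 ^ t)) ^ 2 := by
    rw [ht, show 8 * t + 6 = 2 * (4 * t + 3) by ring, pow_mul', pow_add, pow_mul, one_div_pow 2 4,
      one_div_pow]
    norm_num [mul_comm]
  obtain ⟨u, hu⟩ : ∃ u : ℝ, u = Fintype.card n / (8 * 16 ^ t) := ⟨_, rfl⟩
  have hcard : (Fintype.card n : ℝ) = u * (8 * 16 ^ t) := by rw [hu]; field_simp
  have hpos : 0 < u := by rw [hu]; positivity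
  have hquad : u ^ 2 - u = 2 := by
    rw [hpow, hcard] at htrace
    field_simp at htrace
    linarith
  have hdim : (Module.finrank ℝ (Subalgebra.centralizer ℝ (Set.range γ)) : ℝ) = 4 := by
    have hu2 : u = 2 := by nlinarith
    rw [hγ.finrank_centralizer hm, hpow, hcard, hu2]
    field_simp
    norm_num
  exact_mod_cast hdim

end IsCliffordFamily

end SymmetricCliffordFamilies

section QuaternionRecognition

variable {A : Type*} [Ring A] [Algebra ℝ A] [StarRing A]

theorem exists_smul_mul_self_eq_neg_one
    (hself : ∀ x : A, IsSelfAdjoint x → ∃ r : ℝ, x = r • 1)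
    (hpos : ∀ (x : A) (r : ℝ), x ≠ 0 → star x * x = r • 1 → 0 < r)
    {x : A} (hx : star x = -x) (hx0 : x ≠ 0) : ∃ c : ℝ, (c • x) * (c • x) = -1 := by
  obtain ⟨r, hr⟩ := hself (star x * x) (IsSelfAdjoint.star_mul_self x)
  have hr0 : 0 < r := hpos x r hx0 hr
  have hsq : x * x = -(r • 1) := by rw [← hr, hx, neg_mul, neg_neg]
  refine ⟨(√r)⁻¹, ?_⟩
  rw [smul_mul_smul_comm, hsq, ← mul_inv, Real.mul_self_sqrt hr0.le, smul_neg, smul_smul,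
    inv_mul_cancel₀ hr0.ne', one_smul]

theorem exists_star_eq_neg_notMem_span
    (hself : ∀ x : A, IsSelfAdjoint x → ∃ r : ℝ, x = r • 1) (s : Finset A)
    (hs : s.card + 1 < Module.finrank ℝ A) :
    ∃ x : A, star x = -x ∧ x ∉ Submodule.span ℝ (s : Set A) := by
  classical
  obtain ⟨y, hy⟩ : ∃ y, y ∉ Submodule.span ℝ ((insert 1 s : Finset A) : Set A) := by
    by_contra! h
    have htop : Submodule.span ℝ ((insert 1 s : Finset A) : Set A) = ⊤ :=
      eq_top_iff.mpr fun y _ => h y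
    have hle := finrank_span_finset_le_card (R := ℝ) (insert 1 s : Finset A)
    rw [Set.finrank, htop, finrank_top] at hle
    exact absurd (hle.trans (Finset.card_insert_le 1 s)) (by omega)
  refine ⟨y - star y, by simp, fun hmem => hy ?_⟩
  obtain ⟨r, hr⟩ := hself (y + star y) (IsSelfAdjoint.add_star_self y)
  have hdecomp : y = (r / 2) • 1 + (1 / 2 : ℝ) • (y - star y) := by
    rw [div_eq_mul_one_div, mul_comm, mul_smul, ← hr]
    module
  rw [hdecomp, Finset.coe_insert]
  exact add_mem (Submodule.smul_mem _ _ (Submodule.subset_span (Set.mem_insert _ _)))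
    (Submodule.smul_mem _ _ (Submodule.span_mono (Set.subset_insert _ _) hmem))

theorem exists_star_eq_neg_anticommute [StarModule ℝ A]
    (hself : ∀ x : A, IsSelfAdjoint x → ∃ r : ℝ, x = r • 1) (hd : 2 < Module.finrank ℝ A)
    {i : A} (hi : star i = -i) (hii : i * i = -1) :
    ∃ j : A, j ≠ 0 ∧ star j = -j ∧ j * i = -(i * j) := by
  obtain ⟨z, hz, hzi⟩ := exists_star_eq_neg_notMem_span hself {i} (by simpa using hd)
  obtain ⟨a, ha⟩ := hself (i * z + z * i) (by simp [IsSelfAdjoint, hi, hz, add_comm])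
  refine ⟨z + (a / 2) • i, fun h => hzi ?_, ?_, ?_⟩
  · rw [eq_neg_of_add_eq_zero_left h, ← neg_smul]
    exact Submodule.smul_mem _ _ (Submodule.subset_span (by simp))
  · rw [star_add, star_smul, hz, hi, star_trivial, smul_neg, neg_add]
  · rw [eq_neg_iff_add_eq_zero, mul_add, add_mul, mul_smul_comm, smul_mul_assoc, hii,
      add_add_add_comm, add_comm (z * i), ha]
    module

theorem nonempty_quaternion_algEquiv [StarModule ℝ A] (hd : Module.finrank ℝ A = 4)
    (hself : ∀ x : A, IsSelfAdjoint x → ∃ r : ℝ, x = r • 1)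
    (hpos : ∀ (x : A) (r : ℝ), x ≠ 0 → star x * x = r • 1 → 0 < r) :
    Nonempty (ℍ[ℝ] ≃ₐ[ℝ] A) := by
  obtain ⟨x, hx, hx0⟩ := exists_star_eq_neg_notMem_span hself ∅ (by simp [hd])
  obtain ⟨c, hi⟩ := exists_smul_mul_self_eq_neg_one hself hpos hx (by simpa using hx0)
  obtain ⟨y, hy0, hy, hyx⟩ := exists_star_eq_neg_anticommute hself (by simp [hd])
    (i := c • x) (by rw [star_smul, hx, star_trivial, smul_neg]) hi
  obtain ⟨d, hj⟩ := exists_smul_mul_self_eq_neg_one hself hpos hy hy0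
  let q : QuaternionAlgebra.Basis A (-1 : ℝ) 0 (-1) :=
    { i := c • x
      j := d • y
      k := (c • x) * (d • y)
      i_mul_i := by simpa using hi
      j_mul_j := by simpa using hj
      i_mul_j := rfl
      j_mul_i := by
        simp only [smul_mul_assoc d, mul_smul_comm d, hyx, smul_neg, zero_smul, zero_sub] }
  let φ : ℍ[ℝ] →ₐ[ℝ] A := q.liftHom
  have : Nontrivial A := ⟨y, 0, hy0⟩
  have : FiniteDimensional ℝ A := FiniteDimensional.of_finrank_pos (by omega)
  have hinj : Function.Injective φ := φ.toRingHom.injective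
  have hsurj : Function.Surjective φ :=
    (LinearMap.injective_iff_surjective_of_finrank_eq_finrank (f := φ.toLinearMap)
      (Quaternion.finrank_eq_four.trans hd.symm)).mp hinj
  exact ⟨AlgEquiv.ofBijective φ ⟨hinj, hsurj⟩⟩

end QuaternionRecognition

section MatrixCentralizers

variable {n : Type*} [Fintype n] [DecidableEq n]

theorem pos_of_transpose_mul_self_eq_smul_one {X : Matrix n n ℝ} {r : ℝ} (hX : X ≠ 0)
    (h : Xᵀ * X = r • 1) : 0 < r := by
  obtain ⟨i, j, hij⟩ : ∃ i j, X i j ≠ 0 := by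
    by_contra! h0
    exact hX (Matrix.ext h0)
  have hjj : r = ∑ k, X k j * X k j := by
    simpa [Matrix.mul_apply] using (congrFun (congrFun h j) j).symm
  rw [hjj]
  exact Finset.sum_pos' (fun k _ => mul_self_nonneg _) ⟨i, Finset.mem_univ i, mul_self_pos.mpr hij⟩

theorem IsCliffordFamily.nonempty_quaternion_algEquiv_centralizer [Nonempty n] {m t : ℕ}
    {γ : Fin m → Matrix n n ℝ} (hγ : IsCliffordFamily γ) (hs : ∀ i, (γ i).IsSymm)
    (ht : m = 8 * t + 6)
    (hirr : ∀ X : Matrix n n ℝ, X.IsSymm → (∀ i, γ i * X = X * γ i) → ∃ r : ℝ, X = r • 1) :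
    Nonempty (ℍ[ℝ] ≃ₐ[ℝ] Subalgebra.centralizer ℝ (Set.range γ)) := by
  have hstar : star (Set.range γ) = Set.range γ := by
    have hγs : star ∘ γ = γ := funext fun i => hs i
    rw [← Set.image_star, ← Set.range_comp, hγs]
  have hcentralizer : (StarSubalgebra.centralizer ℝ (Set.range γ)).toSubalgebra =
      Subalgebra.centralizer ℝ (Set.range γ) := by
    rw [StarSubalgebra.centralizer_toSubalgebra, hstar, Set.union_self]
  have hmem {X : Matrix n n ℝ} (hX : X ∈ StarSubalgebra.centralizer ℝ (Set.range γ)) (i : Fin m) :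
      γ i * X = X * γ i :=
    ((StarSubalgebra.mem_centralizer_iff ℝ).mp hX (γ i) (Set.mem_range_self i)).1
  obtain ⟨Ψ⟩ := SpinHeis.nonempty_quaternion_algEquiv
    (A := StarSubalgebra.centralizer ℝ (Set.range γ))
    (by rw [← hγ.finrank_centralizer_eq_four hs ht hirr, ← hcentralizer]; rfl)
    (fun X hX => by
      obtain ⟨r, hr⟩ := hirr X (congrArg Subtype.val hX) (hmem X.2)
      exact ⟨r, Subtype.ext hr⟩)
    (fun X r hX h => pos_of_transpose_mul_self_eq_smul_one (Subtype.coe_injective.ne hX)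
      (congrArg Subtype.val h))
  exact ⟨Ψ.trans (Subalgebra.equivOfEq _ _ hcentralizer)⟩

end MatrixCentralizers

section InvariantForms

variable {V ι : Type*} [AddCommGroup V] [Module ℝ V]

theorem exists_orthonormal_basis_of_form [FiniteDimensional ℝ V] (β : LinearMap.BilinForm ℝ V)
    (hsymm : ∀ x y, β x y = β y x) (hpos : ∀ x, x ≠ 0 → 0 < β x x) :
    ∃ v : Module.Basis (Fin (Module.finrank ℝ V)) ℝ V, ∀ i x, v.repr x i = β (v i) x := by
  let core : InnerProductSpace.Core ℝ V :=
    { inner := fun x y => β x y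
      conj_inner_symm := fun x y => hsymm y x
      re_inner_nonneg := fun x => by
        rcases eq_or_ne x 0 with rfl | hx
        · simp
        · exact (hpos x hx).le
      add_left := by simp
      smul_left := by simp
      definite := fun x h => by
        by_contra hx
        exact (hpos x hx).ne' h }
  let _ : NormedAddCommGroup V := core.toNormedAddCommGroup
  let _ : InnerProductSpace ℝ V := InnerProductSpace.ofCore core.toCore
  refine ⟨(stdOrthonormalBasis ℝ V).toBasis, fun i x => ?_⟩
  rw [OrthonormalBasis.coe_toBasis_repr_apply, OrthonormalBasis.repr_apply_apply,
    OrthonormalBasis.coe_toBasis]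
  rfl

namespace IsCliffordFamily

theorem map {R R' : Type*} [Ring R] [Ring R'] {γ : ι → R} (hγ : IsCliffordFamily γ)
    (f : R →+* R') : IsCliffordFamily fun i => f (γ i) where
  sq i := by rw [← map_mul, hγ.sq, map_one]
  anticomm i j hij := by rw [← map_mul, hγ.anticomm i j hij, map_neg, map_mul]

variable {γ : ι → Module.End ℝ V}

theorem apply_apply (hγ : IsCliffordFamily γ) (i : ι) (x : V) : γ i (γ i x) = x := by
  rw [← Module.End.mul_apply, hγ.sq, Module.End.one_apply]

theorem apply_comm (hγ : IsCliffordFamily γ) {i j : ι} (h : i ≠ j) (x : V) :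
    γ i (γ j x) = -γ j (γ i x) := by
  rw [← Module.End.mul_apply, hγ.anticomm i j h]
  rfl

theorem exists_finite_stable (hγ : IsCliffordFamily γ) (L : List ι) (v : V) :
    ∃ W : Submodule ℝ V, v ∈ W ∧ FiniteDimensional ℝ W ∧ ∀ i ∈ L, ∀ w ∈ W, γ i w ∈ W := by
  induction L with
  | nil => exact ⟨Submodule.span ℝ {v}, Submodule.mem_span_singleton_self v, inferInstance, by simp⟩
  | cons j L ih =>
    obtain ⟨W, hv, hW, hs⟩ := ih
    refine ⟨W ⊔ W.map (γ j), Submodule.mem_sup_left hv, inferInstance, fun i hi w hw => ?_⟩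
    obtain ⟨x, hx, y, ⟨z, hz, rfl⟩, rfl⟩ := Submodule.mem_sup.mp hw
    rw [map_add]
    by_cases hij : i = j
    · subst hij
      rw [hγ.apply_apply]
      exact Submodule.add_mem _ (Submodule.mem_sup_right (Submodule.mem_map_of_mem hx))
        (Submodule.mem_sup_left hz)
    · have hiL : i ∈ L := (List.mem_cons.mp hi).resolve_left hij
      rw [hγ.apply_comm hij]
      exact Submodule.add_mem _ (Submodule.mem_sup_left (hs i hiL x hx))
        (Submodule.neg_mem _ (Submodule.mem_sup_right (Submodule.mem_map_of_mem (hs i hiL z hz))))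

theorem exists_invariant_form [FiniteDimensional ℝ V] (hγ : IsCliffordFamily γ) (L : List ι) :
    ∃ β : LinearMap.BilinForm ℝ V, (∀ x y, β x y = β y x) ∧ (∀ x, x ≠ 0 → 0 < β x x) ∧
      ∀ i ∈ L, ∀ x y, β (γ i x) (γ i y) = β x y := by
  induction L with
  | nil =>
    let φ : V ≃ₗ[ℝ] EuclideanSpace ℝ (Fin (Module.finrank ℝ V)) :=
      LinearEquiv.ofFinrankEq _ _ (by simp)
    refine ⟨(innerₗ _).compl₁₂ φ.toLinearMap φ.toLinearMap, fun x y => ?_, fun x hx => ?_, by simp⟩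
    · simp [real_inner_comm]
    · simpa using pow_pos (norm_pos_iff.mpr (φ.map_ne_zero_iff.mpr hx)) 2
  | cons j L ih =>
    obtain ⟨β, hsymm, hpos, hinv⟩ := ih
    refine ⟨β + β.compl₁₂ (γ j) (γ j), fun x y => ?_, fun x hx => ?_, fun i hi x y => ?_⟩
    · simp [hsymm x, hsymm (γ j x)]
    · have hx' : γ j x ≠ 0 := fun h => hx (by rw [← hγ.apply_apply j x, h, map_zero])
      simpa using add_pos (hpos x hx) (hpos _ hx')
    · simp only [LinearMap.add_apply, LinearMap.compl₁₂_apply]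
      by_cases hij : i = j
      · subst hij
        rw [hγ.apply_apply, hγ.apply_apply, add_comm]
      · have hiL : i ∈ L := (List.mem_cons.mp hi).resolve_left hij
        rw [hγ.apply_comm (Ne.symm hij), hγ.apply_comm (Ne.symm hij) y, hinv i hiL]
        simp [hinv i hiL]

theorem exists_basis_isSymm [Finite ι] [FiniteDimensional ℝ V] (hγ : IsCliffordFamily γ) :
    ∃ v : Module.Basis (Fin (Module.finrank ℝ V)) ℝ V,
      ∀ i, (LinearMap.toMatrixAlgEquiv v (γ i)).IsSymm := by
  have := Fintype.ofFinite ι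
  obtain ⟨β, hsymm, hpos, hinv⟩ := hγ.exists_invariant_form Finset.univ.toList
  obtain ⟨v, hv⟩ := exists_orthonormal_basis_of_form β hsymm hpos
  have hadj (i : ι) (x y : V) : β (γ i x) y = β x (γ i y) := by
    rw [← hinv i (Finset.mem_toList.mpr (Finset.mem_univ i)) x, hγ.apply_apply]
  refine ⟨v, fun i => Matrix.IsSymm.ext fun j k => ?_⟩
  rw [LinearMap.toMatrixAlgEquiv_apply, LinearMap.toMatrixAlgEquiv_apply, hv, hv, ← hadj, hsymm]

end IsCliffordFamily

theorem exists_hasEigenvalue_of_isSymm {n : Type*} [Fintype n] [DecidableEq n] [Nonempty n]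
    [FiniteDimensional ℝ V] (v : Module.Basis n ℝ V) {f : Module.End ℝ V}
    (hf : (LinearMap.toMatrixAlgEquiv v f).IsSymm) : ∃ r : ℝ, f.HasEigenvalue r := by
  have hH : (LinearMap.toMatrixAlgEquiv v f).IsHermitian := hf
  refine ⟨hH.eigenvalues (Classical.arbitrary n), Module.End.hasEigenvalue_iff_mem_spectrum.mpr ?_⟩
  rw [← AlgEquiv.spectrum_eq (LinearMap.toMatrixAlgEquiv v) f]
  exact hH.eigenvalues_mem_spectrum_real _

end InvariantForms

section SchurAlgebra

variable {E : Type*} [NormedAddCommGroup E] [InnerProductSpace ℝ E]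
variable {S₀ : Type*} [AddCommGroup S₀] [Module ℝ S₀] [Module (ClE E) S₀]
  [IsScalarTower ℝ (ClE E) S₀]

theorem clMul_mul_self (e : E) : clMul S₀ e * clMul S₀ e = (inner ℝ e e : ℝ) • 1 := by
  ext s
  rw [Module.End.mul_apply, clMul_clMul]
  simp [euclForm]

theorem clMul_mul_add_swap (e f : E) :
    clMul S₀ e * clMul S₀ f + clMul S₀ f * clMul S₀ e = (2 * inner ℝ e f : ℝ) • 1 := by
  have h := clMul_mul_self (S₀ := S₀) (e + f)
  rw [map_add, mul_add, add_mul, add_mul, clMul_mul_self, clMul_mul_self, inner_add_left,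
    inner_add_right, inner_add_right, real_inner_comm e f] at h
  calc _ = ((inner ℝ e e : ℝ) • 1 + clMul S₀ f * clMul S₀ e +
        (clMul S₀ e * clMul S₀ f + (inner ℝ f f : ℝ) • 1)) - (inner ℝ e e : ℝ) • 1
        - (inner ℝ f f : ℝ) • 1 := by abel
    _ = _ := by rw [h]; module

theorem isCliffordFamily_clMul {ι : Type*} {e : ι → E} (he : Orthonormal ℝ e) :
    IsCliffordFamily fun i => clMul S₀ (e i) where
  sq i := by rw [clMul_mul_self, real_inner_self_eq_norm_sq, he.1 i, one_pow, one_smul]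
  anticomm i j hij := eq_neg_of_add_eq_zero_left <| by
    rw [clMul_mul_add_swap, he.2 hij, mul_zero, zero_smul]

theorem mem_evenSchur_iff {x : Module.End ℝ S₀} :
    x ∈ evenSchur E S₀ ↔ ∀ e : E, clMul S₀ e * x = x * clMul S₀ e := by
  simp [evenSchur, Subalgebra.mem_centralizer_iff]

theorem eq_top_of_clMul_stable [IsSimpleModule (ClE E) S₀] {W : Submodule ℝ S₀} (hW : W ≠ ⊥)
    (h : ∀ e : E, ∀ w ∈ W, clMul S₀ e w ∈ W) : W = ⊤ := by
  have hsmul (a : ClE E) : ∀ w ∈ W, a • w ∈ W := by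
    induction a using CliffordAlgebra.induction with
    | algebraMap r => intro w hw; rw [algebraMap_smul]; exact W.smul_mem r hw
    | ι x => exact h x
    | mul a b ha hb => intro w hw; rw [mul_smul]; exact ha _ (hb w hw)
    | add a b ha hb => intro w hw; rw [add_smul]; exact W.add_mem (ha w hw) (hb w hw)
  let W' : Submodule (ClE E) S₀ := { W with smul_mem' := fun a w hw => hsmul a w hw }
  have hW' : W'.restrictScalars ℝ = W := rfl
  rcases eq_bot_or_eq_top W' with h0 | h1
  · exact absurd (by rw [← hW', h0, Submodule.restrictScalars_bot]) hW
  · rw [← hW', h1, Submodule.restrictScalars_top]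

theorem eq_smul_one_of_mem_evenSchur [IsSimpleModule (ClE E) S₀] {x : Module.End ℝ S₀}
    (hx : x ∈ evenSchur E S₀) {r : ℝ} (hr : x.HasEigenvalue r) : x = r • 1 := by
  have htop : x.eigenspace r = ⊤ := eq_top_of_clMul_stable hr fun e w hw => by
    rw [Module.End.mem_eigenspace_iff] at hw ⊢
    rw [← Module.End.mul_apply, ← mem_evenSchur_iff.mp hx e, Module.End.mul_apply, hw, map_smul]
  ext w
  exact Module.End.mem_eigenspace_iff.mp (htop ▸ Submodule.mem_top)

section OrthonormalBases

variable {ι : Type*} [Fintype ι] (ε : OrthonormalBasis ι ℝ E)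

theorem clMul_eq_sum (e : E) : clMul S₀ e = ∑ i, (inner ℝ (ε i) e : ℝ) • clMul S₀ (ε i) := by
  conv_lhs => rw [← ε.sum_repr' e, map_sum]
  simp only [map_smul]

theorem evenSchur_eq_centralizer :
    evenSchur E S₀ = Subalgebra.centralizer ℝ (Set.range fun i => clMul S₀ (ε i)) := by
  ext x
  rw [mem_evenSchur_iff, Subalgebra.mem_centralizer_iff, Set.forall_mem_range]
  refine ⟨fun h i => h _, fun h e => ?_⟩
  rw [clMul_eq_sum ε e, Finset.sum_mul, Finset.mul_sum]
  simp only [smul_mul_assoc, mul_smul_comm, h]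

theorem finiteDimensional_of_isSimpleModule (ε : OrthonormalBasis ι ℝ E)
    [IsSimpleModule (ClE E) S₀] : FiniteDimensional ℝ S₀ := by
  have : Nontrivial S₀ := IsSimpleModule.nontrivial (ClE E) S₀
  obtain ⟨v, hv⟩ := exists_ne (0 : S₀)
  obtain ⟨W, hvW, hW, hs⟩ := (isCliffordFamily_clMul (S₀ := S₀) ε.orthonormal).exists_finite_stable
    Finset.univ.toList v
  have htop : W = ⊤ := eq_top_of_clMul_stable (fun h => hv (by simpa [h] using hvW))
    fun e w hw => by
      rw [clMul_eq_sum ε e, LinearMap.sum_apply]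
      exact Submodule.sum_mem _ fun i _ => Submodule.smul_mem _ _ (hs i (by simp) w hw)
  subst htop
  exact Module.Finite.equiv Submodule.topEquiv

end OrthonormalBases

theorem nonempty_quaternion_algEquiv_evenSchur {m : ℕ} (hm : m ≡ 6 [MOD 8])
    (ε : OrthonormalBasis (Fin m) ℝ E) [IsSimpleModule (ClE E) S₀] :
    Nonempty (ℍ[ℝ] ≃ₐ[ℝ] evenSchur E S₀) := by
  have : Nontrivial S₀ := IsSimpleModule.nontrivial (ClE E) S₀
  have : FiniteDimensional ℝ S₀ := finiteDimensional_of_isSimpleModule ε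
  have : Nonempty (Fin (Module.finrank ℝ S₀)) := ⟨⟨0, Module.finrank_pos⟩⟩
  have hγ := isCliffordFamily_clMul (S₀ := S₀) ε.orthonormal
  obtain ⟨v, hv⟩ := hγ.exists_basis_isSymm
  let φ := LinearMap.toMatrixAlgEquiv v
  have hmem {x : Module.End ℝ S₀} : x ∈ evenSchur E S₀ ↔
      φ x ∈ Subalgebra.centralizer ℝ (Set.range fun i => φ (clMul S₀ (ε i))) := by
    simp only [evenSchur_eq_centralizer ε, Subalgebra.mem_centralizer_iff, Set.forall_mem_range,
      ← map_mul, φ.injective.eq_iff]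
  have hmap : (evenSchur E S₀).map φ.toAlgHom =
      Subalgebra.centralizer ℝ (Set.range fun i => φ (clMul S₀ (ε i))) := by
    ext X
    obtain ⟨x, rfl⟩ := φ.surjective X
    rw [← hmem]
    exact Subalgebra.mem_map.trans ⟨fun ⟨y, hy, h⟩ => φ.injective h ▸ hy, fun hx => ⟨x, hx, rfl⟩⟩
  obtain ⟨Ψ⟩ := (hγ.map φ.toRingEquiv.toRingHom).nonempty_quaternion_algEquiv_centralizer hv
    (t := m / 8) (by have : m % 8 = 6 := hm; omega) fun X hX hcomm => by
      obtain ⟨x, rfl⟩ := φ.surjective X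
      obtain ⟨r, hr⟩ := exists_hasEigenvalue_of_isSymm v hX
      refine ⟨r, ?_⟩
      rw [eq_smul_one_of_mem_evenSchur (hmem.mpr <| by
        simpa [Subalgebra.mem_centralizer_iff] using hcomm) hr, map_smul, map_one]
  exact ⟨(Ψ.trans (Subalgebra.equivOfEq _ _ hmap.symm)).trans (φ.subalgebraMap _).symm⟩

end SchurAlgebra

section QuaternionicClifford

variable {R : Type*} [Ring R]

theorem commute_mul_of_anticommute {v x y : R} (hx : v * x = -(x * v)) (hy : v * y = -(y * v)) :
    Commute v (x * y) := by
  rw [Commute, SemiconjBy, ← mul_assoc, hx, neg_mul, mul_assoc, hy, mul_neg, neg_neg, mul_assoc]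

variable [Algebra ℝ R]

theorem eq_zero_and_eq_zero_of_add_eq_zero {v x y : R} (hv : IsUnit v) (hx : Commute v x)
    (hy : v * y = -(y * v)) (h : x + y = 0) : x = 0 ∧ y = 0 := by
  have hyx : y = -x := eq_neg_of_add_eq_zero_right h
  have hxv : (2 : ℝ) • (x * v) = 0 := by
    rw [hyx, mul_neg, neg_mul, neg_neg, hx.eq, neg_eq_iff_add_eq_zero] at hy
    rw [two_smul, hy]
  have hx0 : x = 0 := hv.mul_left_eq_zero.mp ((smul_eq_zero_iff_right two_ne_zero).mp hxv)
  exact ⟨hx0, by rw [hyx, hx0, neg_zero]⟩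

variable {E : Type*} [NormedAddCommGroup E] [InnerProductSpace ℝ E]

/-- The algebra generated by the action `c` of the vectors on an irreducible Clifford module of
quaternionic type: the quaternions `Q` commute with the vectors, only quaternions do, and `W` plays
the role of a volume form that anticommutes with the vectors and squares to `-1`. -/
structure IsQuaternionicClifford (Q : ℍ[ℝ] →ₐ[ℝ] R) (c : E →ₗ[ℝ] R) (W : R) : Prop where
  mul_add_swap : ∀ e f, c e * c f + c f * c e = (2 * inner ℝ e f : ℝ) • 1
  commute_vec : ∀ e h, Commute (c e) (Q h)
  commute_vol : ∀ h, Commute W (Q h)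
  vec_mul_vol : ∀ e, c e * W = -(W * c e)
  vol_mul_vol : W * W = -1
  exists_eq_of_commute : ∀ x, (∀ e, Commute (c e) x) → ∃ h, x = Q h

/-- The element `a + b W` of the complexified quaternions generated by `Q` and `W`. -/
def cx (Q : ℍ[ℝ] →ₐ[ℝ] R) (W : R) (a b : ℍ[ℝ]) : R := Q a + Q b * W

/-- The coefficient algebra: the elements that commute with `W` and with the products of two
vectors. -/
def evenCentralizer (c : E →ₗ[ℝ] R) (W : R) : Subalgebra ℝ R :=
  Subalgebra.centralizer ℝ (insert W (Set.range fun v : E × E => c v.1 * c v.2))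

theorem cx_sub (Q : ℍ[ℝ] →ₐ[ℝ] R) (W : R) (a b a' b' : ℍ[ℝ]) :
    cx Q W a b - cx Q W a' b' = cx Q W (a - a') (b - b') := by
  simp only [cx, map_sub]
  noncomm_ring

variable {Q : ℍ[ℝ] →ₐ[ℝ] R} {c : E →ₗ[ℝ] R} {W : R}

theorem mem_evenCentralizer_iff {x : R} :
    x ∈ evenCentralizer c W ↔ Commute W x ∧ ∀ e f, Commute (c e * c f) x := by
  simp only [evenCentralizer, Subalgebra.mem_centralizer_iff, Set.forall_mem_insert,
    Set.forall_mem_range, Prod.forall, commute_iff_eq]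

namespace IsQuaternionicClifford

theorem vec_mul_vec (H : IsQuaternionicClifford Q c W) (e : E) :
    c e * c e = (inner ℝ e e : ℝ) • 1 := by
  have h := H.mul_add_swap e e
  rw [← two_smul ℝ, mul_smul] at h
  exact smul_right_injective R (two_ne_zero' ℝ) h

theorem vec_mul_vec_of_norm (H : IsQuaternionicClifford Q c W) {e : E} (he : ‖e‖ = 1) :
    c e * c e = 1 := by
  rw [H.vec_mul_vec, real_inner_self_eq_norm_sq, he, one_pow, one_smul]

theorem isUnit_vec (H : IsQuaternionicClifford Q c W) {e : E} (he : e ≠ 0) : IsUnit (c e) := by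
  have hinv : (inner ℝ e e : ℝ)⁻¹ * inner ℝ e e = 1 := inv_mul_cancel₀ (inner_self_ne_zero.mpr he)
  refine ⟨⟨c e, (inner ℝ e e : ℝ)⁻¹ • c e, ?_, ?_⟩, rfl⟩
  · rw [mul_smul_comm, H.vec_mul_vec, smul_smul, hinv, one_smul]
  · rw [smul_mul_assoc, H.vec_mul_vec, smul_smul, hinv, one_smul]

theorem isUnit_vol (H : IsQuaternionicClifford Q c W) : IsUnit W :=
  ⟨⟨W, -W, by rw [mul_neg, H.vol_mul_vol, neg_neg], by rw [neg_mul, H.vol_mul_vol, neg_neg]⟩, rfl⟩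

theorem vol_mul_vec (H : IsQuaternionicClifford Q c W) (e : E) : W * c e = -(c e * W) := by
  rw [H.vec_mul_vol, neg_neg]

theorem anticommute_of_inner (H : IsQuaternionicClifford Q c W) {e f : E}
    (hef : inner ℝ e f = 0) : c e * c f = -(c f * c e) :=
  eq_neg_of_add_eq_zero_left <| by rw [H.mul_add_swap, hef, mul_zero, zero_smul]

theorem vec_mul_cx (H : IsQuaternionicClifford Q c W) (e : E) (a b : ℍ[ℝ]) :
    c e * cx Q W a b = cx Q W a (-b) * c e := by
  calc c e * cx Q W a b = c e * Q a + c e * Q b * W := by rw [cx, mul_add, mul_assoc]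
    _ = Q a * c e + Q b * (c e * W) := by
      rw [(H.commute_vec e a).eq, (H.commute_vec e b).eq, mul_assoc]
    _ = cx Q W a (-b) * c e := by
      rw [H.vec_mul_vol, cx, map_neg]
      noncomm_ring

theorem cx_mul_cx (H : IsQuaternionicClifford Q c W) (a b a' b' : ℍ[ℝ]) :
    cx Q W a b * cx Q W a' b' = cx Q W (a * a' - b * b') (a * b' + b * a') := by
  calc cx Q W a b * cx Q W a' b'
      = Q a * Q a' + Q a * Q b' * W + Q b * (W * Q a') + Q b * (W * Q b') * W := by
        simp only [cx]
        noncomm_ring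
    _ = Q a * Q a' + Q a * Q b' * W + Q b * Q a' * W + Q b * Q b' * (W * W) := by
        rw [(H.commute_vol a').eq, (H.commute_vol b').eq]
        noncomm_ring
    _ = cx Q W (a * a' - b * b') (a * b' + b * a') := by
        rw [H.vol_mul_vol, cx]
        simp only [map_sub, map_add, map_mul]
        noncomm_ring

theorem cx_mem_evenCentralizer (H : IsQuaternionicClifford Q c W) (a b : ℍ[ℝ]) :
    cx Q W a b ∈ evenCentralizer c W := by
  refine mem_evenCentralizer_iff.mpr ⟨?_, fun e f => ?_⟩
  · exact (H.commute_vol a).add_right ((H.commute_vol b).mul_right (Commute.refl W))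
  · rw [commute_iff_eq, mul_assoc, H.vec_mul_cx, ← mul_assoc, H.vec_mul_cx, neg_neg, mul_assoc]

theorem cx_eq_zero_iff [Nontrivial R] [Nontrivial E] (H : IsQuaternionicClifford Q c W)
    {a b : ℍ[ℝ]} : cx Q W a b = 0 ↔ a = 0 ∧ b = 0 := by
  refine ⟨fun h => ?_, fun ⟨ha, hb⟩ => by simp [cx, ha, hb]⟩
  obtain ⟨e, he⟩ := exists_ne (0 : E)
  have hanti : c e * (Q b * W) = -(Q b * W * c e) := by
    rw [← mul_assoc, (H.commute_vec e b).eq, mul_assoc, H.vec_mul_vol, mul_neg, mul_assoc]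
  obtain ⟨ha, hb⟩ :=
    eq_zero_and_eq_zero_of_add_eq_zero (H.isUnit_vec he) (H.commute_vec e a) hanti h
  exact ⟨(map_eq_zero Q).mp ha, (map_eq_zero Q).mp (H.isUnit_vol.mul_left_eq_zero.mp hb)⟩

theorem cx_inj [Nontrivial R] [Nontrivial E] (H : IsQuaternionicClifford Q c W)
    {a b a' b' : ℍ[ℝ]} : cx Q W a b = cx Q W a' b' ↔ a = a' ∧ b = b' := by
  rw [← sub_eq_zero, cx_sub, H.cx_eq_zero_iff, sub_eq_zero, sub_eq_zero]

theorem eq_zero_of_sum_eq_zero (H : IsQuaternionicClifford Q c W) {e f g : E} (he : e ≠ 0)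
    (hf : f ≠ 0) (hg : g ≠ 0) (hef : inner ℝ e f = 0) (hge : inner ℝ g e = 0)
    (hgf : inner ℝ g f = 0) {x y z w : R} (hx : x ∈ evenCentralizer c W)
    (hy : y ∈ evenCentralizer c W) (hz : z ∈ evenCentralizer c W) (hw : w ∈ evenCentralizer c W)
    (h : x + y * c e + z * c f + w * (c e * c f) = 0) : x = 0 ∧ y = 0 ∧ z = 0 ∧ w = 0 := by
  rw [mem_evenCentralizer_iff] at hx hy hz hw
  have anticommute_mul {v s t : R} (hs : Commute v s) (ht : v * t = -(t * v)) :
      v * (s * t) = -(s * t * v) := by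
    rw [← mul_assoc, hs.eq, mul_assoc, ht, mul_neg, mul_assoc]
  have hcomm : Commute (c g * c e) (c f) := (commute_mul_of_anticommute
    (by rw [H.anticommute_of_inner hgf, neg_neg])
    (by rw [H.anticommute_of_inner hef, neg_neg])).symm
  have hanti : c g * c e * c e = -(c e * (c g * c e)) := by
    rw [← mul_assoc, H.anticommute_of_inner hge, neg_mul]
  obtain ⟨heven, hodd⟩ := eq_zero_and_eq_zero_of_add_eq_zero H.isUnit_vol
    (x := x + w * (c e * c f)) (y := y * c e + z * c f)
    (hx.1.add_right (hw.1.mul_right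
      (commute_mul_of_anticommute (H.vol_mul_vec e) (H.vol_mul_vec f))))
    (by rw [mul_add, anticommute_mul hy.1 (H.vol_mul_vec e),
      anticommute_mul hz.1 (H.vol_mul_vec f), add_mul, neg_add])
    (by rw [← h]; abel)
  have hunit := (H.isUnit_vec hg).mul (H.isUnit_vec he)
  obtain ⟨hx0, hw0⟩ := eq_zero_and_eq_zero_of_add_eq_zero hunit (hx.2 g e)
    (anticommute_mul (hw.2 g e) <| by
      rw [← mul_assoc, hanti, neg_mul, mul_assoc, hcomm.eq, mul_assoc]) heven
  obtain ⟨hz0, hy0⟩ := eq_zero_and_eq_zero_of_add_eq_zero hunit ((hz.2 g e).mul_right hcomm)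
    (anticommute_mul (hy.2 g e) hanti) ((add_comm _ _).trans hodd)
  exact ⟨hx0, (H.isUnit_vec he).mul_left_eq_zero.mp hy0, (H.isUnit_vec hf).mul_left_eq_zero.mp hz0,
    ((H.isUnit_vec he).mul (H.isUnit_vec hf)).mul_left_eq_zero.mp hw0⟩

end IsQuaternionicClifford

end QuaternionicClifford

section DiagonalBlocks

variable {R : Type*} [Ring R] [Algebra ℝ R]
variable {E : Type*} [NormedAddCommGroup E] [InnerProductSpace ℝ E]
variable {Q : ℍ[ℝ] →ₐ[ℝ] R} {c : E →ₗ[ℝ] R} {W : R}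

theorem commute_vec_of_commute_orthogonal {f : E} (hf : ‖f‖ = 1) {x : R} (hxf : Commute (c f) x)
    (hx : ∀ e, inner ℝ e f = 0 → Commute (c e) x) (e : E) : Commute (c e) x := by
  have horth : inner ℝ (e - (inner ℝ e f : ℝ) • f) f = 0 := by
    rw [inner_sub_left, real_inner_smul_left, real_inner_self_eq_norm_sq, hf, one_pow, mul_one,
      sub_self]
  have hadd := (hx _ horth).add_left (hxf.smul_left (inner ℝ e f : ℝ))
  rwa [← map_smul, ← map_add, sub_add_cancel] at hadd

namespace IsQuaternionicClifford

theorem exists_eq_mul_vol_of_anticommute (H : IsQuaternionicClifford Q c W) {x : R}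
    (hx : ∀ e, c e * x = -(x * c e)) : ∃ h, x = Q h * W := by
  obtain ⟨h, hh⟩ := H.exists_eq_of_commute (x * W) fun e =>
    commute_mul_of_anticommute (hx e) (H.vec_mul_vol e)
  refine ⟨-h, ?_⟩
  rw [map_neg, ← hh, neg_mul, mul_assoc, H.vol_mul_vol, mul_neg, mul_one, neg_neg]

theorem exists_eq_add_of_commute_orthogonal (H : IsQuaternionicClifford Q c W) {f : E}
    (hf : ‖f‖ = 1) {x : R} (hx : ∀ e, inner ℝ e f = 0 → Commute (c e) x) :
    ∃ a b, x = Q a + Q b * (c f * W) := by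
  have hff := H.vec_mul_vec_of_norm hf
  have hffx (z : R) : c f * (c f * z) = z := by rw [← mul_assoc, hff, one_mul]
  have hfxf (e : E) (he : inner ℝ e f = 0) : Commute (c e) (c f * x * c f) := by
    have hef := H.anticommute_of_inner he
    rw [mul_assoc]
    exact commute_mul_of_anticommute hef
      (by rw [← mul_assoc, (hx e he).eq, mul_assoc, hef, mul_neg, mul_assoc])
  have hfW : c f * W * (c f * W) = 1 := by
    rw [mul_assoc, ← mul_assoc W, H.vol_mul_vec, neg_mul, mul_neg, mul_assoc, hffx, H.vol_mul_vol,
      neg_neg]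
  obtain ⟨a, ha⟩ := H.exists_eq_of_commute (x + c f * x * c f) <|
    commute_vec_of_commute_orthogonal hf
      (by rw [commute_iff_eq, mul_add, add_mul, mul_assoc _ (c f) (c f), hff, mul_one,
        mul_assoc, hffx, add_comm])
      fun e he => (hx e he).add_right (hfxf e he)
  obtain ⟨b, hb⟩ := H.exists_eq_of_commute ((x - c f * x * c f) * (c f * W)) <|
    commute_vec_of_commute_orthogonal hf
      (commute_mul_of_anticommute
        (by rw [mul_sub, sub_mul, mul_assoc _ (c f) (c f), hff, mul_one, mul_assoc, hffx,
          neg_sub])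
        (by rw [mul_assoc, H.vol_mul_vec, mul_neg, neg_neg]))
      fun e he => ((hx e he).sub_right (hfxf e he)).mul_right
        (commute_mul_of_anticommute (H.anticommute_of_inner he) (H.vec_mul_vol e))
  refine ⟨(1 / 2 : ℝ) • a, (1 / 2 : ℝ) • b, ?_⟩
  rw [map_smul, map_smul, ← ha, ← hb, smul_mul_assoc, mul_assoc (x - _), hfW, mul_one]
  module

theorem vec_mul_eq_mul_vec_swap (H : IsQuaternionicClifford Q c W) {e : E} {a d : R}
    (h : c e * d = a * c e) : c e * a = d * c e := by
  rcases eq_or_ne e 0 with rfl | he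
  · rw [map_zero, zero_mul, mul_zero]
  · refine (H.isUnit_vec he).mul_right_cancel ?_
    rw [mul_assoc, ← h, mul_assoc d, H.vec_mul_vec, ← mul_assoc, H.vec_mul_vec, smul_mul_assoc,
      one_mul, mul_smul_comm, mul_one]

theorem vec_mul_sub_mul_vec_of_eq_add (H : IsQuaternionicClifford Q c W) {f : E} (hf : ‖f‖ = 1)
    {x : R} {p q : ℍ[ℝ]} (hx : x = Q p + Q q * (c f * W)) :
    c f * x - x * c f = (2 : ℝ) • (Q q * W) := by
  have hfW : c f * (c f * W) = W := by rw [← mul_assoc, H.vec_mul_vec_of_norm hf, one_mul]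
  have hWf : c f * W * c f = -W := by rw [mul_assoc, H.vol_mul_vec, mul_neg, hfW]
  rw [hx, mul_add, (H.commute_vec f p).eq, ← mul_assoc, (H.commute_vec f q).eq, mul_assoc, hfW,
    add_mul, mul_assoc (Q q), hWf, mul_neg]
  module

theorem vec_mul_add_mul_vec_of_mul_vec_eq_add (H : IsQuaternionicClifford Q c W) {f : E}
    (hf : ‖f‖ = 1) {y : R} {r t : ℍ[ℝ]} (hy : y * c f = Q r + Q t * (c f * W)) :
    c f * y + y * c f = (2 : ℝ) • Q r := by
  have hff := H.vec_mul_vec_of_norm hf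
  have hy' : y = Q r * c f - Q t * W := by
    rw [← mul_one y, ← hff, ← mul_assoc, hy, add_mul, mul_assoc (Q t), mul_assoc (c f),
      H.vol_mul_vec, mul_neg, ← mul_assoc (c f), hff, one_mul, mul_neg, sub_eq_add_neg]
  rw [hy', mul_sub, sub_mul, ← mul_assoc, ← mul_assoc, (H.commute_vec f r).eq,
    (H.commute_vec f t).eq, mul_assoc, hff, mul_assoc (Q t), H.vec_mul_vol, mul_assoc (Q t),
    mul_neg, mul_one]
  module

theorem exists_eq_cx (H : IsQuaternionicClifford Q c W) {f : E} (hf : ‖f‖ = 1) {a d Z : R}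
    (h : ∀ e, c e * d - a * c e = (inner ℝ e f : ℝ) • Z) : ∃ h₁ h₂, Z = cx Q W h₁ h₂ := by
  have hd (e : E) (he : inner ℝ e f = 0) : c e * d = a * c e := by
    rw [← sub_eq_zero, h, he, zero_smul]
  have ha (e : E) (he : inner ℝ e f = 0) : c e * a = d * c e := H.vec_mul_eq_mul_vec_swap (hd e he)
  have hanti (e : E) (he : inner ℝ e f = 0) : c e * (a - d) = -((a - d) * c e) := by
    rw [mul_sub, ha e he, hd e he, sub_mul, neg_sub]
  obtain ⟨p, q, hpq⟩ := H.exists_eq_add_of_commute_orthogonal hf (x := a + d) fun e he => by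
    rw [commute_iff_eq, mul_add, ha e he, hd e he, add_mul, add_comm]
  obtain ⟨r, t, hrt⟩ := H.exists_eq_add_of_commute_orthogonal hf (x := (a - d) * c f) fun e he =>
    commute_mul_of_anticommute (hanti e he) (H.anticommute_of_inner he)
  have hfZ : c f * d - a * c f = Z := by
    rw [h, real_inner_self_eq_norm_sq, hf, one_pow, one_smul]
  have hZ : (2 : ℝ) • Z = (2 : ℝ) • cx Q W (-r) q := by
    calc (2 : ℝ) • Z
        = (c f * (a + d) - (a + d) * c f) - (c f * (a - d) + (a - d) * c f) := by
          rw [← hfZ, two_smul]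
          noncomm_ring
      _ = (2 : ℝ) • cx Q W (-r) q := by
          rw [H.vec_mul_sub_mul_vec_of_eq_add hf hpq,
            H.vec_mul_add_mul_vec_of_mul_vec_eq_add hf hrt, cx, map_neg]
          module
  exact ⟨-r, q, smul_right_injective R (two_ne_zero' ℝ) hZ⟩

end IsQuaternionicClifford

/-- The upper diagonal block `e ↦ ½ (h₃(e) - h₁ e + h₂ e W + h₄(e) W)` of a representation with
parameters `h₁, h₂, h₃, h₄`. -/
def diagUpper (Q : ℍ[ℝ] →ₐ[ℝ] R) (c : E →ₗ[ℝ] R) (W : R) (h₁ h₂ : ℍ[ℝ]) (h₃ h₄ : E →ₗ[ℝ] ℍ[ℝ]) :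
    E →ₗ[ℝ] R where
  toFun e := (1 / 2 : ℝ) • (Q (h₃ e) - Q h₁ * c e + Q h₂ * c e * W + Q (h₄ e) * W)
  map_add' e f := by
    simp only [map_add, mul_add, add_mul]
    module
  map_smul' r e := by
    simp only [map_smul, mul_smul_comm, smul_mul_assoc, RingHom.id_apply]
    module

/-- The lower diagonal block `e ↦ ½ (h₃(e) + h₁ e + h₂ e W - h₄(e) W)` of a representation with
parameters `h₁, h₂, h₃, h₄`. -/
def diagLower (Q : ℍ[ℝ] →ₐ[ℝ] R) (c : E →ₗ[ℝ] R) (W : R) (h₁ h₂ : ℍ[ℝ]) (h₃ h₄ : E →ₗ[ℝ] ℍ[ℝ]) :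
    E →ₗ[ℝ] R where
  toFun e := (1 / 2 : ℝ) • (Q (h₃ e) + Q h₁ * c e + Q h₂ * c e * W - Q (h₄ e) * W)
  map_add' e f := by
    simp only [map_add, mul_add, add_mul]
    module
  map_smul' r e := by
    simp only [map_smul, mul_smul_comm, smul_mul_assoc, RingHom.id_apply]
    module

theorem diagUpper_apply (h₁ h₂ : ℍ[ℝ]) (h₃ h₄ : E →ₗ[ℝ] ℍ[ℝ]) (e : E) :
    diagUpper Q c W h₁ h₂ h₃ h₄ e
      = (1 / 2 : ℝ) • (Q (h₃ e) - Q h₁ * c e + Q h₂ * c e * W + Q (h₄ e) * W) := rfl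

theorem diagLower_eq_diagUpper_neg (h₁ h₂ : ℍ[ℝ]) (h₃ h₄ : E →ₗ[ℝ] ℍ[ℝ]) :
    diagLower Q c W h₁ h₂ h₃ h₄ = diagUpper Q c W (-h₁) h₂ h₃ (-h₄) := by
  ext e
  rw [diagUpper_apply, LinearMap.neg_apply, map_neg, map_neg, neg_mul, neg_mul, sub_neg_eq_add,
    ← sub_eq_add_neg]
  rfl

theorem diagUpper_add (h₁ h₂ : ℍ[ℝ]) (h₃ h₄ : E →ₗ[ℝ] ℍ[ℝ]) :
    diagUpper Q c W 0 0 h₃ h₄ + diagUpper Q c W h₁ h₂ 0 0 = diagUpper Q c W h₁ h₂ h₃ h₄ := by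
  ext e
  simp only [LinearMap.add_apply, diagUpper_apply, map_zero, zero_mul, LinearMap.zero_apply]
  module

namespace IsQuaternionicClifford

theorem diagUpper_eq (H : IsQuaternionicClifford Q c W) (h₁ h₂ : ℍ[ℝ]) (h₃ h₄ : E →ₗ[ℝ] ℍ[ℝ])
    (e : E) : diagUpper Q c W h₁ h₂ h₃ h₄ e
      = (1 / 2 : ℝ) • (cx Q W (h₃ e) (h₄ e) - cx Q W h₁ h₂ * c e) := by
  rw [diagUpper_apply, cx, cx, add_mul, mul_assoc (Q h₂) W, H.vol_mul_vec, mul_assoc (Q h₂)]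
  congr 1
  noncomm_ring

theorem diagLower_eq (H : IsQuaternionicClifford Q c W) (h₁ h₂ : ℍ[ℝ]) (h₃ h₄ : E →ₗ[ℝ] ℍ[ℝ])
    (e : E) : diagLower Q c W h₁ h₂ h₃ h₄ e
      = (1 / 2 : ℝ) • (cx Q W (h₃ e) (-h₄ e) + cx Q W h₁ (-h₂) * c e) := by
  rw [diagLower_eq_diagUpper_neg, H.diagUpper_eq, LinearMap.neg_apply, sub_eq_add_neg, ← neg_mul]
  congr 3
  simp only [cx, map_neg]
  noncomm_ring

theorem vec_mul_diagLower_sub (H : IsQuaternionicClifford Q c W) (h₁ h₂ : ℍ[ℝ])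
    (h₃ h₄ : E →ₗ[ℝ] ℍ[ℝ]) (e f : E) :
    c e * diagLower Q c W h₁ h₂ h₃ h₄ f - diagUpper Q c W h₁ h₂ h₃ h₄ f * c e
      = (inner ℝ e f : ℝ) • cx Q W h₁ h₂ := by
  have h : c e * (cx Q W (h₃ f) (-h₄ f) + cx Q W h₁ (-h₂) * c f)
      - (cx Q W (h₃ f) (h₄ f) - cx Q W h₁ h₂ * c f) * c e
      = cx Q W h₁ h₂ * (c e * c f + c f * c e) := by
    rw [mul_add, H.vec_mul_cx, ← mul_assoc (c e), H.vec_mul_cx, neg_neg, neg_neg]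
    noncomm_ring
  rw [H.diagLower_eq, H.diagUpper_eq, mul_smul_comm, smul_mul_assoc, ← smul_sub, h,
    H.mul_add_swap, mul_smul_comm, mul_one, smul_smul, ← mul_assoc, one_div,
    inv_mul_cancel₀ two_ne_zero, one_mul]

theorem exists_eq_diag_zero [Nontrivial R] (H : IsQuaternionicClifford Q c W) {a d : E →ₗ[ℝ] R}
    (h : ∀ e f, c e * d f = a f * c e) :
    ∃ h₃ h₄ : E →ₗ[ℝ] ℍ[ℝ], a = diagUpper Q c W 0 0 h₃ h₄ ∧ d = diagLower Q c W 0 0 h₃ h₄ := by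
  have hswap (e f : E) : c e * a f = d f * c e := H.vec_mul_eq_mul_vec_swap (h e f)
  have hadd (f : E) : ∃ q, a f + d f = Q q := H.exists_eq_of_commute _ fun e => by
    rw [commute_iff_eq, mul_add, h, hswap, add_mul, add_comm]
  have hsub (f : E) : ∃ q, a f - d f = Q q * W := H.exists_eq_mul_vol_of_anticommute fun e => by
    rw [mul_sub, h, hswap, sub_mul, neg_sub]
  obtain ⟨P, hP⟩ := LinearMap.exists_leftInverse_of_injective Q.toLinearMap
    (LinearMap.ker_eq_bot.mpr (RingHom.injective Q.toRingHom))
  have hPQ (q : ℍ[ℝ]) : P (Q q) = q := LinearMap.congr_fun hP q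
  have h₃ (f : E) : Q (P (a f + d f)) = a f + d f := by
    obtain ⟨q, hq⟩ := hadd f
    rw [hq, hPQ]
  have h₄ (f : E) : Q (P ((a f - d f) * -W)) * W = a f - d f := by
    obtain ⟨q, hq⟩ := hsub f
    rw [hq, mul_assoc, mul_neg, H.vol_mul_vol, neg_neg, mul_one, hPQ]
  refine ⟨P ∘ₗ (a + d), P ∘ₗ LinearMap.mulRight ℝ (-W) ∘ₗ (a - d), ?_, ?_⟩ <;> ext f
  · change a f = (1 / 2 : ℝ) • (Q (P (a f + d f)) - Q 0 * c f + Q 0 * c f * W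
      + Q (P ((a f - d f) * -W)) * W)
    rw [h₃, h₄, map_zero, zero_mul, zero_mul]
    module
  · change d f = (1 / 2 : ℝ) • (Q (P (a f + d f)) + Q 0 * c f + Q 0 * c f * W
      - Q (P ((a f - d f) * -W)) * W)
    rw [h₃, h₄, map_zero, zero_mul, zero_mul]
    module

theorem exists_eq_diag [Nontrivial R] [Nontrivial E] (H : IsQuaternionicClifford Q c W)
    {a d : E →ₗ[ℝ] R} {Z : R} (h : ∀ e f, c e * d f - a f * c e = (inner ℝ e f : ℝ) • Z) :
    ∃ (h₁ h₂ : ℍ[ℝ]) (h₃ h₄ : E →ₗ[ℝ] ℍ[ℝ]), Z = cx Q W h₁ h₂ ∧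
      a = diagUpper Q c W h₁ h₂ h₃ h₄ ∧ d = diagLower Q c W h₁ h₂ h₃ h₄ := by
  obtain ⟨f, hf⟩ := exists_norm_eq E zero_le_one
  obtain ⟨h₁, h₂, rfl⟩ := H.exists_eq_cx hf fun e => h e f
  obtain ⟨h₃, h₄, ha, hd⟩ := H.exists_eq_diag_zero (a := a - diagUpper Q c W h₁ h₂ 0 0)
    (d := d - diagLower Q c W h₁ h₂ 0 0) fun e f => by
      rw [← sub_eq_zero, LinearMap.sub_apply, LinearMap.sub_apply, mul_sub, sub_mul,
        sub_sub_sub_comm, h, H.vec_mul_diagLower_sub, sub_self]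
  refine ⟨h₁, h₂, h₃, h₄, rfl, ?_, ?_⟩
  · rw [← sub_add_cancel a (diagUpper Q c W h₁ h₂ 0 0), ha]
    exact diagUpper_add h₁ h₂ h₃ h₄
  · rw [← sub_add_cancel d (diagLower Q c W h₁ h₂ 0 0), hd]
    rw [diagLower_eq_diagUpper_neg, diagLower_eq_diagUpper_neg, diagLower_eq_diagUpper_neg,
      neg_zero, neg_zero, diagUpper_add]

end IsQuaternionicClifford

end DiagonalBlocks

section QuaternionSolution

variable {E : Type*} [AddCommGroup E] [Module ℝ E]
variable {h₁ h₂ : ℍ[ℝ]} {h₃ h₄ : E →ₗ[ℝ] ℍ[ℝ]}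

/-- The equations on the parameters `h₁, h₂, h₃, h₄` which say that the upper diagonal blocks
commute with each other. -/
structure IsQuaternionSolution (h₁ h₂ : ℍ[ℝ]) (h₃ h₄ : E →ₗ[ℝ] ℍ[ℝ]) : Prop where
  sq_add_sq : h₁ * h₁ + h₂ * h₂ = 0
  commute : Commute h₁ h₂
  lie_fst : ∀ e, ⁅h₃ e, h₁⁆ = h₄ e * h₂ + h₂ * h₄ e
  lie_snd : ∀ e, ⁅h₃ e, h₂⁆ = -(h₄ e * h₁ + h₁ * h₄ e)
  lie_lie : ∀ e f, ⁅h₃ e, h₃ f⁆ = ⁅h₄ e, h₄ f⁆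
  lie_mixed : ∀ e f, ⁅h₃ e, h₄ f⁆ = ⁅h₃ f, h₄ e⁆

theorem IsQuaternionSolution.neg (hs : IsQuaternionSolution h₁ h₂ h₃ h₄) :
    IsQuaternionSolution (-h₁) h₂ h₃ (-h₄) where
  sq_add_sq := by rw [neg_mul_neg, hs.sq_add_sq]
  commute := hs.commute.neg_left
  lie_fst e := by rw [lie_neg, hs.lie_fst, LinearMap.neg_apply, neg_mul, mul_neg, neg_add]
  lie_snd e := by rw [hs.lie_snd, LinearMap.neg_apply, neg_mul_neg, neg_mul_neg]
  lie_lie e f := by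
    rw [hs.lie_lie, LinearMap.neg_apply, LinearMap.neg_apply, neg_lie, lie_neg, neg_neg]
  lie_mixed e f := by
    rw [LinearMap.neg_apply, LinearMap.neg_apply, lie_neg, lie_neg, hs.lie_mixed]

end QuaternionSolution

section CommutationOfDiagonalBlocks

variable {R : Type*} [Ring R] [Algebra ℝ R]
variable {E : Type*} [NormedAddCommGroup E] [InnerProductSpace ℝ E]
variable {Q : ℍ[ℝ] →ₐ[ℝ] R} {c : E →ₗ[ℝ] R} {W : R} {h₁ h₂ : ℍ[ℝ]} {h₃ h₄ : E →ₗ[ℝ] ℍ[ℝ]}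

theorem exists_ne_zero_orthogonal (s : Finset E) (hs : s.card < Module.finrank ℝ E) :
    ∃ g : E, g ≠ 0 ∧ ∀ e ∈ s, inner ℝ g e = 0 := by
  have : FiniteDimensional ℝ E := Module.finite_of_finrank_pos (Nat.zero_lt_of_lt hs)
  have htop : Submodule.span ℝ (s : Set E) ≠ ⊤ := fun h => by
    have hle := finrank_span_finset_le_card (R := ℝ) s
    rw [Set.finrank, h, finrank_top] at hle
    exact hs.not_ge hle
  obtain ⟨g, hg, hg0⟩ := Submodule.exists_mem_ne_zero_of_ne_bot
    fun h => htop (Submodule.orthogonal_eq_bot_iff.mp h)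
  exact ⟨g, hg0, fun e he => Submodule.inner_left_of_mem_orthogonal (Submodule.subset_span he) hg⟩

namespace IsQuaternionicClifford

theorem isQuaternionSolution_iff [Nontrivial R] [Nontrivial E] (H : IsQuaternionicClifford Q c W) :
    IsQuaternionSolution h₁ h₂ h₃ h₄ ↔
      cx Q W h₁ h₂ * cx Q W h₁ (-h₂) = 0 ∧
      (∀ e, cx Q W (h₃ e) (h₄ e) * cx Q W h₁ h₂ = cx Q W h₁ h₂ * cx Q W (h₃ e) (-h₄ e)) ∧
      ∀ e f, Commute (cx Q W (h₃ e) (h₄ e)) (cx Q W (h₃ f) (h₄ f)) := by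
  simp only [commute_iff_eq, H.cx_mul_cx, H.cx_inj, H.cx_eq_zero_iff, mul_neg, sub_neg_eq_add,
    neg_add_eq_zero]
  constructor
  · rintro ⟨hsq, hcomm, hfst, hsnd, hlie, hmixed⟩
    simp only [Ring.lie_def] at hfst hsnd hlie hmixed
    refine ⟨⟨hsq, hcomm⟩, fun e => ⟨?_, ?_⟩, fun e f => ⟨?_, ?_⟩⟩
    · linear_combination (norm := abel) hfst e
    · linear_combination (norm := abel) hsnd e
    · linear_combination (norm := abel) hlie e f
    · linear_combination (norm := abel) hmixed e f
  · rintro ⟨⟨hsq, hcomm⟩, hz, hw⟩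
    refine ⟨hsq, hcomm, fun e => ?_, fun e => ?_, fun e f => ?_, fun e f => ?_⟩ <;>
      simp only [Ring.lie_def]
    · linear_combination (norm := abel) (hz e).1
    · linear_combination (norm := abel) (hz e).2
    · linear_combination (norm := abel) (hw e f).1
    · linear_combination (norm := abel) (hw e f).2

theorem lie_diagUpper (H : IsQuaternionicClifford Q c W) (h₁ h₂ : ℍ[ℝ]) (h₃ h₄ : E →ₗ[ℝ] ℍ[ℝ])
    (e f : E) :
    (4 : ℝ) • ⁅diagUpper Q c W h₁ h₂ h₃ h₄ e, diagUpper Q c W h₁ h₂ h₃ h₄ f⁆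
      = ⁅cx Q W (h₃ e) (h₄ e), cx Q W (h₃ f) (h₄ f)⁆
        + (cx Q W (h₃ f) (h₄ f) * cx Q W h₁ h₂ - cx Q W h₁ h₂ * cx Q W (h₃ f) (-h₄ f)) * c e
        - (cx Q W (h₃ e) (h₄ e) * cx Q W h₁ h₂ - cx Q W h₁ h₂ * cx Q W (h₃ e) (-h₄ e)) * c f
        + cx Q W h₁ h₂ * cx Q W h₁ (-h₂) * ⁅c e, c f⁆ := by
  have hmul (e f : E) : diagUpper Q c W h₁ h₂ h₃ h₄ e * diagUpper Q c W h₁ h₂ h₃ h₄ f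
      = (1 / 4 : ℝ) • (cx Q W (h₃ e) (h₄ e) * cx Q W (h₃ f) (h₄ f)
        - cx Q W (h₃ e) (h₄ e) * cx Q W h₁ h₂ * c f
        - cx Q W h₁ h₂ * cx Q W (h₃ f) (-h₄ f) * c e
        + cx Q W h₁ h₂ * cx Q W h₁ (-h₂) * (c e * c f)) := by
    rw [H.diagUpper_eq, H.diagUpper_eq, smul_mul_smul_comm, mul_sub, sub_mul, sub_mul,
      mul_assoc _ (c e), H.vec_mul_cx, mul_assoc _ (c e), ← mul_assoc (c e), H.vec_mul_cx]
    congr 1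
    · norm_num
    · noncomm_ring
  rw [Ring.lie_def, hmul, hmul, ← smul_sub, smul_smul, mul_one_div_cancel four_ne_zero, one_smul,
    Ring.lie_def, Ring.lie_def]
  noncomm_ring

theorem commute_diagUpper [Nontrivial R] [Nontrivial E] (H : IsQuaternionicClifford Q c W)
    (hs : IsQuaternionSolution h₁ h₂ h₃ h₄) (e f : E) :
    Commute (diagUpper Q c W h₁ h₂ h₃ h₄ e) (diagUpper Q c W h₁ h₂ h₃ h₄ f) := by
  obtain ⟨hzz, hz, hw⟩ := H.isQuaternionSolution_iff.mp hs
  rw [commute_iff_lie_eq, ← smul_eq_zero_iff_right (four_ne_zero (α := ℝ)), H.lie_diagUpper,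
    (hw e f).lie_eq, hz, hz, hzz]
  simp only [sub_self, zero_mul, add_zero]

theorem commute_diagLower [Nontrivial R] [Nontrivial E] (H : IsQuaternionicClifford Q c W)
    (hs : IsQuaternionSolution h₁ h₂ h₃ h₄) (e f : E) :
    Commute (diagLower Q c W h₁ h₂ h₃ h₄ e) (diagLower Q c W h₁ h₂ h₃ h₄ f) := by
  rw [diagLower_eq_diagUpper_neg]
  exact H.commute_diagUpper hs.neg e f

theorem cx_mul_diagLower [Nontrivial R] [Nontrivial E] (H : IsQuaternionicClifford Q c W)
    (hs : IsQuaternionSolution h₁ h₂ h₃ h₄) (e : E) :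
    cx Q W h₁ h₂ * diagLower Q c W h₁ h₂ h₃ h₄ e
      = diagUpper Q c W h₁ h₂ h₃ h₄ e * cx Q W h₁ h₂ := by
  obtain ⟨hzz, hz, -⟩ := H.isQuaternionSolution_iff.mp hs
  rw [H.diagLower_eq, H.diagUpper_eq, mul_smul_comm, smul_mul_assoc, mul_add, sub_mul, hz,
    mul_assoc _ (c e), H.vec_mul_cx, ← mul_assoc, hzz, zero_mul, add_zero, sub_zero]

theorem coeff_eq_of_commute [Nontrivial R] (H : IsQuaternionicClifford Q c W)
    (hE : 3 ≤ Module.finrank ℝ E)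
    (h : ∀ e f, Commute (diagUpper Q c W h₁ h₂ h₃ h₄ e) (diagUpper Q c W h₁ h₂ h₃ h₄ f))
    {e : E} (he : e ≠ 0) :
    cx Q W (h₃ e) (h₄ e) * cx Q W h₁ h₂ = cx Q W h₁ h₂ * cx Q W (h₃ e) (-h₄ e) ∧
      cx Q W h₁ h₂ * cx Q W h₁ (-h₂) = 0 := by
  classical
  obtain ⟨f, hf, hfe⟩ := exists_ne_zero_orthogonal {e} (by rw [Finset.card_singleton]; lia)
  obtain ⟨g, hg, hgef⟩ := exists_ne_zero_orthogonal {e, f} (Finset.card_le_two.trans_lt hE)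
  have hef : inner ℝ e f = 0 := by rw [real_inner_comm, hfe e (Finset.mem_singleton_self e)]
  have hlie := (H.lie_diagUpper h₁ h₂ h₃ h₄ e f).symm.trans
    (by rw [(h e f).lie_eq, smul_zero])
  have hclie : ⁅c e, c f⁆ = (2 : ℝ) • (c e * c f) := by
    rw [Ring.lie_def, H.anticommute_of_inner hef, two_smul]
    abel
  have hmul (a₁ b₁ a₂ b₂ : ℍ[ℝ]) := mul_mem (H.cx_mem_evenCentralizer a₁ b₁)
    (H.cx_mem_evenCentralizer a₂ b₂)
  obtain ⟨-, -, hz, hzz⟩ := H.eq_zero_of_sum_eq_zero he hf hg hef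
    (hgef e (Finset.mem_insert_self e _))
    (hgef f (Finset.mem_insert_of_mem (Finset.mem_singleton_self f)))
    (sub_mem (hmul _ _ _ _) (hmul _ _ _ _))
    (sub_mem (hmul _ _ _ _) (hmul _ _ _ _))
    (neg_mem (sub_mem (hmul _ _ _ _) (hmul _ _ _ _)))
    (Subalgebra.smul_mem _ (hmul _ _ _ _) (2 : ℝ))
    (by rw [← hlie, hclie, mul_smul_comm, smul_mul_assoc, neg_mul, ← sub_eq_add_neg, Ring.lie_def])
  exact ⟨sub_eq_zero.mp (neg_eq_zero.mp hz), (smul_eq_zero_iff_right two_ne_zero).mp hzz⟩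

theorem isQuaternionSolution_of_commute [Nontrivial R] (H : IsQuaternionicClifford Q c W)
    (hE : 3 ≤ Module.finrank ℝ E)
    (h : ∀ e f, Commute (diagUpper Q c W h₁ h₂ h₃ h₄ e) (diagUpper Q c W h₁ h₂ h₃ h₄ f)) :
    IsQuaternionSolution h₁ h₂ h₃ h₄ := by
  have : Nontrivial E := Module.nontrivial_of_finrank_pos (R := ℝ) (by lia)
  obtain ⟨e₀, he₀⟩ := exists_ne (0 : E)
  have hzz := (H.coeff_eq_of_commute hE h he₀).2
  have hz (e : E) :
      cx Q W (h₃ e) (h₄ e) * cx Q W h₁ h₂ = cx Q W h₁ h₂ * cx Q W (h₃ e) (-h₄ e) := by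
    rcases eq_or_ne e 0 with rfl | he
    · simp [cx]
    · exact (H.coeff_eq_of_commute hE h he).1
  refine H.isQuaternionSolution_iff.mpr ⟨hzz, hz, fun e f => ?_⟩
  have hlie := (H.lie_diagUpper h₁ h₂ h₃ h₄ e f).symm.trans (by rw [(h e f).lie_eq, smul_zero])
  rwa [hz, hz, hzz, sub_self, sub_self, zero_mul, zero_mul, zero_mul, add_zero, sub_zero, add_zero,
    ← commute_iff_lie_eq] at hlie

end IsQuaternionicClifford

end CommutationOfDiagonalBlocks

section QuaternionEquations

theorem inner_eq_sum_mul (a b : ℍ[ℝ]) :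
    inner ℝ a b = a.re * b.re + a.imI * b.imI + a.imJ * b.imJ + a.imK * b.imK := by
  rw [Quaternion.inner_def, Quaternion.re_mul]
  simp only [Quaternion.re_star, Quaternion.imI_star, Quaternion.imJ_star, Quaternion.imK_star]
  ring

theorem imCross_eq_half_lie (a b : ℍ[ℝ]) : imCross a b = (1 / 2 : ℝ) • ⁅a, b⁆ := by
  rw [Ring.lie_def]
  ext <;> simp [imCross] <;> ring

theorem lie_lie_eq_inner_smul_sub (n a b : ℍ[ℝ]) :
    ⁅n, ⁅a, b⁆⁆ = (4 : ℝ) • ((inner ℝ n.im b.im : ℝ) • a.im - (inner ℝ n.im a.im : ℝ) • b.im) := by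
  simp only [Ring.lie_def, inner_eq_sum_mul]
  ext <;> simp <;> ring

theorem lie_lie_lie_eq_inner_smul (u a b : ℍ[ℝ]) :
    ⁅⁅u, a⁆, ⁅u, b⁆⁆ = (4 * inner ℝ u.im ⁅a, b⁆ : ℝ) • u.im := by
  simp only [Ring.lie_def, inner_eq_sum_mul]
  ext <;> simp <;> ring

theorem re_lie (a b : ℍ[ℝ]) : ⁅a, b⁆.re = 0 := by
  rw [Ring.lie_def, Quaternion.re_sub, Quaternion.re_mul, Quaternion.re_mul]
  ring

theorem mem_imPerp_iff {n v : ℍ[ℝ]} : v ∈ imPerp n ↔ v.re = 0 ∧ inner ℝ n.im v = 0 := Iff.rfl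

theorem finrank_imPerp_le {n : ℍ[ℝ]} (hn : n.im ≠ 0) : Module.finrank ℝ (imPerp n) ≤ 2 := by
  have hlt : imPerp n < imPerp 0 := by
    refine SetLike.lt_iff_le_and_exists.mpr ⟨fun v hv => mem_imPerp_iff.mpr ⟨hv.1, by simp⟩,
      n.im, mem_imPerp_iff.mpr ⟨Quaternion.re_im n, by simp⟩, fun h => ?_⟩
    exact hn (inner_self_eq_zero.mp (mem_imPerp_iff.mp h).2)
  have hlt_top : imPerp 0 < ⊤ := SetLike.lt_iff_le_and_exists.mpr
    ⟨le_top, 1, Submodule.mem_top, fun h => one_ne_zero (mem_imPerp_iff.mp h).1⟩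
  have hrank := Submodule.finrank_lt_finrank_of_lt hlt
  have hrank_top := Submodule.finrank_lt_finrank_of_lt hlt_top
  rw [finrank_top, Quaternion.finrank_eq_four] at hrank_top
  lia

variable {E : Type*} [AddCommGroup E] [Module ℝ E]

theorem range_le_imPerp_iff {n : ℍ[ℝ]} {φ : E →ₗ[ℝ] ℍ[ℝ]} :
    LinearMap.range (imLin ∘ₗ φ) ≤ imPerp n ↔ ∀ e, inner ℝ n.im (φ e).im = 0 := by
  rw [LinearMap.range_le_iff_comap, Submodule.eq_top_iff']
  exact forall_congr' fun e => and_iff_right (Quaternion.re_im (φ e))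

theorem imCondition_iff {n : ℍ[ℝ]} (hn : n.im ≠ 0) {φ : E →ₗ[ℝ] ℍ[ℝ]} :
    ImCondition n φ ↔ ∀ e f, ⁅n, ⁅φ e, φ f⁆⁆ = 0 := by
  simp only [lie_lie_eq_inner_smul_sub, smul_eq_zero_iff_right (four_ne_zero (α := ℝ)), sub_eq_zero]
  constructor
  · rintro (hrank | hperp) e f
    · obtain ⟨v, hv⟩ := finrank_le_one_iff.mp hrank
      obtain ⟨r, hr⟩ := hv ⟨_, LinearMap.mem_range_self _ e⟩
      obtain ⟨t, ht⟩ := hv ⟨_, LinearMap.mem_range_self _ f⟩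
      have hre : (φ e).im = r • (v : ℍ[ℝ]) := (congrArg Subtype.val hr).symm
      have htf : (φ f).im = t • (v : ℍ[ℝ]) := (congrArg Subtype.val ht).symm
      rw [hre, htf, inner_smul_right, inner_smul_right, smul_smul, smul_smul]
      congr 1
      ring
    · have hperp' := range_le_imPerp_iff.mp hperp.le
      rw [hperp', hperp', zero_smul, zero_smul]
  · intro h
    by_cases hperp : ∀ e, inner ℝ n.im (φ e).im = 0
    · rcases Nat.lt_or_ge 1 (Module.finrank ℝ (LinearMap.range (imLin ∘ₗ φ))) with hrank | hrank
      · exact Or.inr (Submodule.eq_of_le_of_finrank_le (range_le_imPerp_iff.mpr hperp)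
          ((finrank_imPerp_le hn).trans hrank))
      · exact Or.inl hrank
    · push Not at hperp
      obtain ⟨e, he⟩ := hperp
      have hspan : LinearMap.range (imLin ∘ₗ φ) ≤ ℝ ∙ (φ e).im := by
        rintro _ ⟨f, rfl⟩
        refine Submodule.mem_span_singleton.mpr
          ⟨(inner ℝ n.im (φ e).im : ℝ)⁻¹ * inner ℝ n.im (φ f).im, ?_⟩
        rw [mul_smul, h, inv_smul_smul₀ he]
        rfl
      exact Or.inl ((Submodule.finrank_mono hspan).trans (by
        simpa using finrank_span_le_card (R := ℝ) ({(φ e).im} : Set ℍ[ℝ])))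

end QuaternionEquations

section Axis

variable {E : Type*} [AddCommGroup E] [Module ℝ E]
variable {u h₁ h₂ : ℍ[ℝ]} {x t : ℝ} {h₃ h₄ : E →ₗ[ℝ] ℍ[ℝ]}

/-- The parameters `h₁, h₂, h₃, h₄` are those attached to the imaginary unit `u` and to the complex
number `x + t u`: `h₂ = x + t u`, `h₁ = -u h₂`, and `h₄ = u × h₃`. -/
structure HasAxis (u : ℍ[ℝ]) (x t : ℝ) (h₁ h₂ : ℍ[ℝ]) (h₃ h₄ : E →ₗ[ℝ] ℍ[ℝ]) : Prop where
  axis_mul_axis : u * u = -1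
  fst_eq : h₁ = t • 1 - x • u
  snd_eq : h₂ = x • 1 + t • u
  apply_eq : ∀ e, h₄ e = (1 / 2 : ℝ) • ⁅u, h₃ e⁆
  lie_lie : ∀ e f, ⁅u, ⁅h₃ e, h₃ f⁆⁆ = 0

theorem norm_eq_one_of_mul_self_eq_neg_one (hu : u * u = -1) : ‖u‖ = 1 := by
  have h := congrArg norm hu
  rw [norm_mul, norm_neg, norm_one, ← pow_two] at h
  exact (pow_eq_one_iff_of_nonneg (norm_nonneg u) two_ne_zero).mp h

theorem re_eq_zero_of_mul_self_eq_neg_one (hu : u * u = -1) : u.re = 0 := by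
  refine Quaternion.sq_eq_neg_normSq.mp ?_
  rw [pow_two, hu, Quaternion.normSq_eq_norm_mul_self, norm_eq_one_of_mul_self_eq_neg_one hu,
    mul_one, Quaternion.coe_one]

theorem im_eq_self_of_re_eq_zero (hu : u.re = 0) : u.im = u := by
  conv_rhs => rw [← Quaternion.re_add_im u, hu, Quaternion.coe_zero, zero_add]

theorem eq_re_smul_add_smul_of_commute (hu : u * u = -1) {q : ℍ[ℝ]} (hq : Commute u q) :
    q = q.re • 1 + (inner ℝ u.im q.im : ℝ) • u := by
  have him := im_eq_self_of_re_eq_zero (re_eq_zero_of_mul_self_eq_neg_one hu)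
  have h := lie_lie_eq_inner_smul_sub u u q
  rw [hq.lie_eq, lie_zero, eq_comm, smul_eq_zero_iff_right four_ne_zero, him,
    real_inner_self_eq_norm_sq, norm_eq_one_of_mul_self_eq_neg_one hu, one_pow, one_smul,
    sub_eq_zero] at h
  rw [him, h, Algebra.smul_def, mul_one]
  exact (Quaternion.re_add_im q).symm

theorem lie_smul_one_add_smul (a u : ℍ[ℝ]) (x t : ℝ) : ⁅a, x • 1 + t • u⁆ = -(t • ⁅u, a⁆) := by
  rw [lie_add, lie_smul, lie_smul, ← lie_skew a u, Ring.lie_def a 1, mul_one, one_mul, sub_self,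
    smul_zero, zero_add, smul_neg]

theorem mul_smul_one_add_smul_add_swap (a u : ℍ[ℝ]) (x t : ℝ) :
    a * (x • 1 + t • u) + (x • 1 + t • u) * a = (2 * x) • a + t • (a * u + u * a) := by
  simp only [add_mul, mul_add, smul_mul_assoc, mul_smul_comm, one_mul, mul_one]
  module

namespace HasAxis

theorem im_axis (hA : HasAxis u x t h₁ h₂ h₃ h₄) : u.im = u :=
  im_eq_self_of_re_eq_zero (re_eq_zero_of_mul_self_eq_neg_one hA.axis_mul_axis)

theorem apply_mul_axis (hA : HasAxis u x t h₁ h₂ h₃ h₄) (e : E) : h₄ e * u + u * h₄ e = 0 := by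
  have h : ⁅u, h₃ e⁆ * u + u * ⁅u, h₃ e⁆ = u * u * h₃ e - h₃ e * (u * u) := by
    rw [Ring.lie_def]
    noncomm_ring
  rw [hA.apply_eq, smul_mul_assoc, mul_smul_comm, ← smul_add, h, hA.axis_mul_axis, neg_one_mul,
    mul_neg_one, sub_self, smul_zero]

theorem lie_apply_apply (hA : HasAxis u x t h₁ h₂ h₃ h₄) (e f : E) :
    ⁅h₄ e, h₄ f⁆ = ⁅h₃ e, h₃ f⁆ := by
  have him := im_eq_self_of_re_eq_zero (re_lie (h₃ e) (h₃ f))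
  have hlie := eq_re_smul_add_smul_of_commute hA.axis_mul_axis
    (commute_iff_lie_eq.mpr (hA.lie_lie e f))
  rw [re_lie, zero_smul, zero_add, him, hA.im_axis] at hlie
  rw [hA.apply_eq, hA.apply_eq, smul_lie, lie_smul, lie_lie_lie_eq_inner_smul, smul_smul,
    smul_smul, hA.im_axis]
  refine Eq.trans ?_ hlie.symm
  congr 1
  ring

theorem isQuaternionSolution (hA : HasAxis u x t h₁ h₂ h₃ h₄) :
    IsQuaternionSolution h₁ h₂ h₃ h₄ where
  sq_add_sq := by
    rw [hA.fst_eq, hA.snd_eq]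
    simp only [sub_mul, mul_sub, add_mul, mul_add, smul_mul_assoc, mul_smul_comm, hA.axis_mul_axis,
      one_mul, mul_one]
    module
  commute := by
    rw [commute_iff_eq, hA.fst_eq, hA.snd_eq]
    simp only [sub_mul, mul_sub, add_mul, mul_add, smul_mul_assoc, mul_smul_comm, one_mul, mul_one]
    module
  lie_fst e := by
    rw [hA.fst_eq, hA.snd_eq, sub_eq_add_neg, ← neg_smul, lie_smul_one_add_smul,
      mul_smul_one_add_smul_add_swap, hA.apply_mul_axis, hA.apply_eq]
    module
  lie_snd e := by
    rw [hA.fst_eq, hA.snd_eq, sub_eq_add_neg, ← neg_smul, lie_smul_one_add_smul,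
      mul_smul_one_add_smul_add_swap, hA.apply_mul_axis, hA.apply_eq]
    module
  lie_lie e f := (hA.lie_apply_apply e f).symm
  lie_mixed e f := by
    have hjacobi := leibniz_lie u (h₃ e) (h₃ f)
    rw [hA.lie_lie, ← lie_skew (⁅u, h₃ e⁆), neg_add_eq_sub, eq_comm, sub_eq_zero] at hjacobi
    rw [hA.apply_eq, hA.apply_eq, lie_smul, lie_smul, hjacobi]

end HasAxis

namespace IsQuaternionSolution

theorem snd_ne_zero (hs : IsQuaternionSolution h₁ h₂ h₃ h₄) (h : h₁ ≠ 0 ∨ h₂ ≠ 0) : h₂ ≠ 0 := by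
  rintro rfl
  have hsq := hs.sq_add_sq
  rw [mul_zero, add_zero, mul_self_eq_zero] at hsq
  exact h.elim (· hsq) (· rfl)

theorem exists_axis (hs : IsQuaternionSolution h₁ h₂ h₃ h₄) (h₂0 : h₂ ≠ 0) :
    ∃ (u : ℍ[ℝ]) (x t : ℝ), u * u = -1 ∧ h₁ = t • 1 - x • u ∧ h₂ = x • 1 + t • u := by
  set u := -(h₁ * h₂⁻¹) with hu
  have hcomm : Commute h₁ h₂⁻¹ := hs.commute.inv_right₀
  have huu : u * u = -1 := by
    have h₁sq : h₁ * h₁ = -(h₂ * h₂) := eq_neg_of_add_eq_zero_left hs.sq_add_sq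
    calc u * u = h₁ * (h₂⁻¹ * h₁) * h₂⁻¹ := by rw [hu, neg_mul_neg]; simp only [mul_assoc]
      _ = h₁ * h₁ * (h₂⁻¹ * h₂⁻¹) := by rw [← hcomm.eq]; simp only [mul_assoc]
      _ = -1 := by
        rw [h₁sq, neg_mul, mul_assoc, mul_inv_cancel_left₀ h₂0, mul_inv_cancel₀ h₂0]
  have hu₂ : Commute u h₂ := (hs.commute.mul_left (Commute.inv_left₀ (Commute.refl h₂))).neg_left
  have hh₂ := eq_re_smul_add_smul_of_commute huu hu₂
  refine ⟨u, h₂.re, inner ℝ u.im h₂.im, huu, ?_, hh₂⟩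
  calc h₁ = -(u * h₂) := by rw [hu, neg_mul, neg_neg, inv_mul_cancel_right₀ h₂0]
    _ = _ := by
      rw [hh₂, mul_add, mul_smul_comm, mul_smul_comm, huu, mul_one, ← hh₂]
      module

theorem exists_hasAxis (hs : IsQuaternionSolution h₁ h₂ h₃ h₄) (h₂0 : h₂ ≠ 0) :
    ∃ u x t, (x ≠ 0 ∨ t ≠ 0) ∧ HasAxis u x t h₁ h₂ h₃ h₄ := by
  obtain ⟨u, x, t, huu, hh₁, hh₂⟩ := hs.exists_axis h₂0
  have hxt : x ≠ 0 ∨ t ≠ 0 := by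
    contrapose! h₂0
    rw [hh₂, h₂0.1, h₂0.2, zero_smul, zero_smul, zero_add]
  have hh₄ (e : E) : h₄ e = (1 / 2 : ℝ) • ⁅u, h₃ e⁆ := by
    have hfst := hs.lie_fst e
    have hsnd := hs.lie_snd e
    rw [hh₁, hh₂, sub_eq_add_neg, ← neg_smul, lie_smul_one_add_smul,
      mul_smul_one_add_smul_add_swap] at hfst hsnd
    have hpos : x ^ 2 + t ^ 2 ≠ 0 := by
      rcases hxt with h | h <;> positivity
    refine smul_right_injective _ hpos ?_
    linear_combination (norm := module) -(x / 2) • hfst + (t / 2) • hsnd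
  refine ⟨u, x, t, hxt, huu, hh₁, hh₂, hh₄, fun e f => ?_⟩
  have hu := im_eq_self_of_re_eq_zero (re_eq_zero_of_mul_self_eq_neg_one huu)
  rw [hs.lie_lie, hh₄, hh₄, smul_lie, lie_smul, lie_smul, lie_lie_lie_eq_inner_smul, hu,
    lie_smul, lie_smul, lie_self, smul_zero, smul_zero, smul_zero]

end IsQuaternionSolution

end Axis

section Families

variable {E : Type*} [AddCommGroup E] [Module ℝ E]
variable {u h₁ h₂ : ℍ[ℝ]} {s x t : ℝ} {h₃ h₄ : E →ₗ[ℝ] ℍ[ℝ]}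

theorem im_lie (n a : ℍ[ℝ]) : ⁅n.im, a⁆ = ⁅n, a⁆ := by
  conv_rhs => rw [← Quaternion.re_add_im n]
  rw [add_lie, commute_iff_lie_eq.mp (Quaternion.coe_commute n.re a), zero_add]

theorem smul_imCross (r : ℝ) (n a : ℍ[ℝ]) :
    r • imCross n a = (1 / 2 : ℝ) • ⁅r • n.im, a⁆ := by
  rw [imCross_eq_half_lie, smul_lie, im_lie, smul_comm]

theorem imCondition_iff_smul_im {n : ℍ[ℝ]} (hn : n.im ≠ 0) {r : ℝ} (hr : r ≠ 0) :
    ImCondition n h₃ ↔ ∀ e f, ⁅r • n.im, ⁅h₃ e, h₃ f⁆⁆ = 0 := by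
  simp only [imCondition_iff hn, smul_lie, im_lie, smul_eq_zero_iff_right hr]

theorem smul_im_mul_self {n : ℍ[ℝ]} (hn : n.im ≠ 0) (hs : s * s = 1) :
    (s / ‖n.im‖) • n.im * (s / ‖n.im‖) • n.im = -1 := by
  have hr : ‖n.im‖ ≠ 0 := norm_ne_zero_iff.mpr hn
  have hsq : n.im * n.im = -((‖n.im‖ * ‖n.im‖ : ℝ) • 1) := by
    rw [← pow_two n.im, Quaternion.sq_eq_neg_normSq.mpr (Quaternion.re_im n),
      Quaternion.normSq_eq_norm_mul_self, Algebra.smul_def, mul_one]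
    rfl
  rw [smul_mul_smul_comm, hsq, ← smul_neg, smul_smul, div_mul_div_comm, hs,
    div_mul_cancel₀ 1 (mul_ne_zero hr hr), one_smul]

theorem coe_eq_smul_one (r : ℝ) : (r : ℍ[ℝ]) = r • 1 := by
  rw [← Quaternion.coe_one, Quaternion.smul_coe, mul_one]

theorem firstFamily_iff (hs : s * s = 1) : FirstFamily s h₁ h₂ h₃ h₄ ↔
    h₂.im ≠ 0 ∧ HasAxis ((s / ‖h₂.im‖) • h₂.im) h₂.re (s * ‖h₂.im‖) h₁ h₂ h₃ h₄ := by
  refine and_congr_right fun him => ?_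
  have hr : ‖h₂.im‖ ≠ 0 := norm_ne_zero_iff.mpr him
  have hs0 : s ≠ 0 := left_ne_zero_of_mul_eq_one hs
  have hfst : s • ((‖h₂.im‖ : ℍ[ℝ]) - (h₂.re / ‖h₂.im‖) • h₂.im)
      = (s * ‖h₂.im‖) • 1 - h₂.re • (s / ‖h₂.im‖) • h₂.im := by
    rw [coe_eq_smul_one]
    module
  have hsnd : h₂ = h₂.re • 1 + (s * ‖h₂.im‖) • (s / ‖h₂.im‖) • h₂.im := by
    rw [smul_smul, mul_div_assoc', mul_right_comm, hs, one_mul, div_self hr, one_smul,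
      ← coe_eq_smul_one, Quaternion.re_add_im]
  rw [imCondition_iff_smul_im him (div_ne_zero hs0 hr), hfst]
  simp only [smul_imCross]
  exact ⟨fun ⟨hcond, hh₁, hh₄⟩ => ⟨smul_im_mul_self him hs, hh₁, hsnd, hh₄, hcond⟩,
    fun hA => ⟨hA.lie_lie, hA.fst_eq, hA.apply_eq⟩⟩

theorem secondFamily_iff (hs : s * s = 1) : SecondFamily s h₁ h₂ h₃ h₄ ↔
    h₁.im ≠ 0 ∧ HasAxis ((-s / ‖h₁.im‖) • h₁.im) (s * ‖h₁.im‖) 0 h₁ h₂ h₃ h₄ := by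
  rw [SecondFamily, and_left_comm]
  refine and_congr_right fun him => ?_
  have hr : ‖h₁.im‖ ≠ 0 := norm_ne_zero_iff.mpr him
  have hs0 : -s ≠ 0 := neg_ne_zero.mpr (left_ne_zero_of_mul_eq_one hs)
  have hfst : h₁.re = 0 ↔ h₁ = (0 : ℝ) • 1 - (s * ‖h₁.im‖) • (-s / ‖h₁.im‖) • h₁.im := by
    rw [smul_smul, mul_div_assoc', mul_right_comm, mul_neg, hs, neg_one_mul, neg_div,
      div_self hr, neg_one_smul, zero_smul, zero_sub, neg_neg]
    exact ⟨fun h => (im_eq_self_of_re_eq_zero h).symm, fun h => h ▸ Quaternion.re_im h₁⟩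
  have hsnd : s • (‖h₁.im‖ : ℍ[ℝ])
      = (s * ‖h₁.im‖) • 1 + (0 : ℝ) • (-s / ‖h₁.im‖) • h₁.im := by
    rw [coe_eq_smul_one]
    module
  rw [imCondition_iff_smul_im him (div_ne_zero hs0 hr), hsnd, hfst]
  simp only [smul_imCross]
  exact ⟨fun ⟨hh₁, hcond, hh₂, hh₄⟩ =>
      ⟨smul_im_mul_self him (by rw [neg_mul_neg, hs]), hh₁, hh₂, hh₄, hcond⟩,
    fun hA => ⟨hA.fst_eq, hA.lie_lie, hA.snd_eq, hA.apply_eq⟩⟩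

theorem exists_sign_smul_eq (hu : ‖u‖ = 1) (ht : t ≠ 0) :
    ∃ s : ℝ, (s = 1 ∨ s = -1) ∧ t = s * ‖t • u‖ ∧ u = (s / ‖t • u‖) • t • u := by
  have hnorm : ‖t • u‖ = |t| := by rw [norm_smul, hu, mul_one, Real.norm_eq_abs]
  have habs : |t| ≠ 0 := abs_ne_zero.mpr ht
  refine ⟨t / |t|, ?_, ?_, ?_⟩
  · rw [← mul_self_eq_one_iff, div_mul_div_comm, abs_mul_abs_self, div_self (mul_ne_zero ht ht)]
  · rw [hnorm, div_mul_cancel₀ t habs]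
  · rw [hnorm, smul_smul, div_div, div_mul_eq_mul_div, abs_mul_abs_self,
      div_self (mul_ne_zero ht ht), one_smul]

theorem HasAxis.isParameter (hA : HasAxis u x t h₁ h₂ h₃ h₄) (hxt : x ≠ 0 ∨ t ≠ 0) :
    IsParameter h₁ h₂ h₃ h₄ := by
  have hre := re_eq_zero_of_mul_self_eq_neg_one hA.axis_mul_axis
  have hnorm := norm_eq_one_of_mul_self_eq_neg_one hA.axis_mul_axis
  have hu : u ≠ 0 := norm_ne_zero_iff.mp (hnorm.trans_ne one_ne_zero)
  rcases eq_or_ne t 0 with rfl | ht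
  · have hx : -x ≠ 0 := neg_ne_zero.mpr (hxt.resolve_right (· rfl))
    have hh₁ : h₁ = -x • u := by rw [hA.fst_eq, zero_smul, zero_sub, neg_smul]
    have him : h₁.im = -x • u := by
      rw [im_eq_self_of_re_eq_zero (by rw [hh₁, Quaternion.re_smul, hre, smul_zero]), hh₁]
    obtain ⟨s, hs, hxs, hus⟩ := exists_sign_smul_eq hnorm hx
    have hs' : -s = 1 ∨ -s = -1 := by rwa [neg_eq_iff_eq_neg, neg_inj, or_comm]
    refine ⟨-s, hs', Or.inr ((secondFamily_iff (mul_self_eq_one_iff.mpr hs')).mpr ⟨?_, ?_⟩)⟩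
    · rw [him]
      exact smul_ne_zero hx hu
    · rwa [him, neg_neg, ← hus, neg_mul, ← hxs, neg_neg]
  · have him : h₂.im = t • u := by
      rw [hA.snd_eq, ← coe_eq_smul_one, Quaternion.im_add, Quaternion.im_coe, zero_add,
        Quaternion.im_smul, im_eq_self_of_re_eq_zero hre]
    have hh₂ : h₂.re = x := by
      rw [hA.snd_eq, ← coe_eq_smul_one, Quaternion.re_add, Quaternion.re_coe, Quaternion.re_smul,
        hre, smul_zero, add_zero]
    obtain ⟨s, hs, hts, hus⟩ := exists_sign_smul_eq hnorm ht
    refine ⟨s, hs, Or.inl ((firstFamily_iff (mul_self_eq_one_iff.mpr hs)).mpr ⟨?_, ?_⟩)⟩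
    · rw [him]
      exact smul_ne_zero ht hu
    · rwa [him, hh₂, ← hus, ← hts]

theorem isParameter_iff : IsParameter h₁ h₂ h₃ h₄ ↔
    IsQuaternionSolution h₁ h₂ h₃ h₄ ∧ (h₁ ≠ 0 ∨ h₂ ≠ 0) := by
  constructor
  · rintro ⟨s, hs, hfamily⟩
    have hss := mul_self_eq_one_iff.mpr hs
    rcases hfamily with hfirst | hsecond
    · obtain ⟨him, hA⟩ := (firstFamily_iff hss).mp hfirst
      exact ⟨hA.isQuaternionSolution, Or.inr fun h => him (by rw [h, Quaternion.im_zero])⟩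
    · obtain ⟨him, hA⟩ := (secondFamily_iff hss).mp hsecond
      exact ⟨hA.isQuaternionSolution, Or.inl fun h => him (by rw [h, Quaternion.im_zero])⟩
  · rintro ⟨hsol, h0⟩
    obtain ⟨u, x, t, hxt, hA⟩ := hsol.exists_hasAxis (hsol.snd_ne_zero h0)
    exact hA.isParameter hxt

end Families

section VolumeForm

variable {E : Type*} [NormedAddCommGroup E] [InnerProductSpace ℝ E]
variable {S₀ : Type*} [AddCommGroup S₀] [Module ℝ S₀] [Module (ClE E) S₀]
  [IsScalarTower ℝ (ClE E) S₀]
variable {m : ℕ}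

theorem cl_volumeForm (ε : OrthonormalBasis (Fin m) ℝ E) :
    cl S₀ (volumeForm ε) = monomial (fun i => clMul S₀ (ε i)) (List.finRange m) := by
  rw [volumeForm, map_list_prod, List.ofFn_eq_map, List.map_map, monomial]
  rfl

theorem clMul_mul_cl_volumeForm (hm : Even m) (ε : OrthonormalBasis (Fin m) ℝ E) (e : E) :
    clMul S₀ e * cl S₀ (volumeForm ε) = -(cl S₀ (volumeForm ε) * clMul S₀ e) := by
  have hbasis (i : Fin m) : clMul S₀ (ε i) * cl S₀ (volumeForm ε)
      = -(cl S₀ (volumeForm ε) * clMul S₀ (ε i)) := by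
    rw [cl_volumeForm, (isCliffordFamily_clMul (S₀ := S₀) ε.orthonormal).mul_monomial_of_mem
      (List.nodup_finRange m) (List.mem_finRange i), List.length_finRange,
      hm.add_one.neg_one_pow, neg_one_smul]
  rw [clMul_eq_sum ε e, Finset.mul_sum, Finset.sum_mul, ← Finset.sum_neg_distrib]
  simp only [smul_mul_assoc, mul_smul_comm, hbasis, smul_neg]

theorem cl_volumeForm_mul_self (hm : Odd (m.choose 2)) (ε : OrthonormalBasis (Fin m) ℝ E) :
    cl S₀ (volumeForm ε) * cl S₀ (volumeForm ε) = -1 := by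
  rw [cl_volumeForm, (isCliffordFamily_clMul (S₀ := S₀) ε.orthonormal).monomial_mul_self
    (List.nodup_finRange m), List.length_finRange, hm.neg_one_pow, neg_one_smul]

theorem commute_cl_of_mem_evenSchur {x : Module.End ℝ S₀} (hx : x ∈ evenSchur E S₀) (a : ClE E) :
    Commute (cl S₀ a) x := by
  induction a using CliffordAlgebra.induction with
  | algebraMap r => rw [AlgHom.commutes]; exact Algebra.commutes r x
  | ι e => exact mem_evenSchur_iff.mp hx e
  | mul a b ha hb => rw [map_mul]; exact ha.mul_left hb
  | add a b ha hb => rw [map_add]; exact ha.add_left hb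

theorem odd_choose_two {m : ℕ} (hm : m ≡ 6 [MOD 8]) : Odd (m.choose 2) := by
  obtain ⟨t, rfl⟩ : ∃ t, m = 8 * t + 6 := ⟨m / 8, by have : m % 8 = 6 := hm; omega⟩
  rw [Nat.choose_two_right, show 8 * t + 6 - 1 = 8 * t + 5 by omega,
    show (8 * t + 6) * (8 * t + 5) = 2 * (2 * (16 * t ^ 2 + 22 * t + 7) + 1) by ring,
    Nat.mul_div_cancel_left _ two_pos]
  exact ⟨_, rfl⟩

theorem isQuaternionicClifford (hm : m ≡ 6 [MOD 8]) (ε : OrthonormalBasis (Fin m) ℝ E)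
    (Φ : ℍ[ℝ] ≃ₐ[ℝ] evenSchur E S₀) :
    IsQuaternionicClifford (qAct Φ) (clMul S₀ : E →ₗ[ℝ] Module.End ℝ S₀)
      (cl S₀ (volumeForm ε)) where
  mul_add_swap := clMul_mul_add_swap
  commute_vec e h := mem_evenSchur_iff.mp (Φ h).2 e
  commute_vol h := commute_cl_of_mem_evenSchur (Φ h).2 _
  vec_mul_vol := clMul_mul_cl_volumeForm
    (Nat.even_iff.mpr (by have : m % 8 = 6 := hm; omega)) ε
  vol_mul_vol := cl_volumeForm_mul_self (odd_choose_two hm) ε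
  exists_eq_of_commute x hx := by
    obtain ⟨h, hh⟩ := Φ.surjective ⟨x, mem_evenSchur_iff.mpr hx⟩
    exact ⟨h, (congrArg Subtype.val hh).symm⟩

theorem six_le_finrank (hm : m ≡ 6 [MOD 8]) (ε : OrthonormalBasis (Fin m) ℝ E) :
    6 ≤ Module.finrank ℝ E := by
  rw [Module.finrank_eq_card_basis ε.toBasis, Fintype.card_fin]
  have : m % 8 = 6 := hm
  omega

end VolumeForm

section Blocks

variable {S₀ : Type*} [AddCommGroup S₀] [Module ℝ S₀]

theorem block_apply (a b c d : Module.End ℝ S₀) (x : S₀ × S₀) :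
    block a b c d x = (a x.1 + b x.2, c x.1 + d x.2) := rfl

theorem block_mul (a b c d a' b' c' d' : Module.End ℝ S₀) :
    block a b c d * block a' b' c' d'
      = block (a * a' + b * c') (a * b' + b * d') (c * a' + d * c') (c * b' + d * d') := by
  refine LinearMap.ext fun x => ?_
  simp only [Module.End.mul_apply, block_apply, LinearMap.add_apply, map_add]
  exact Prod.ext (add_add_add_comm ..) (add_add_add_comm ..)

theorem block_sub (a b c d a' b' c' d' : Module.End ℝ S₀) :
    block a b c d - block a' b' c' d' = block (a - a') (b - b') (c - c') (d - d') := by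
  refine LinearMap.ext fun x => ?_
  simp only [block_apply, LinearMap.sub_apply]
  exact Prod.ext (add_sub_add_comm ..) (add_sub_add_comm ..)

theorem block_add (a b c d a' b' c' d' : Module.End ℝ S₀) :
    block a b c d + block a' b' c' d' = block (a + a') (b + b') (c + c') (d + d') := by
  refine LinearMap.ext fun x => ?_
  simp only [block_apply, LinearMap.add_apply]
  exact Prod.ext (add_add_add_comm ..) (add_add_add_comm ..)

theorem smul_block (r : ℝ) (a b c d : Module.End ℝ S₀) :
    r • block a b c d = block (r • a) (r • b) (r • c) (r • d) := by
  refine LinearMap.ext fun x => ?_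
  simp [block_apply]

theorem block_inj {a b c d a' b' c' d' : Module.End ℝ S₀} :
    block a b c d = block a' b' c' d' ↔ a = a' ∧ b = b' ∧ c = c' ∧ d = d' := by
  constructor
  · intro h
    have hx (x y : S₀) := congrArg Prod.fst (LinearMap.congr_fun h (x, y))
    have hy (x y : S₀) := congrArg Prod.snd (LinearMap.congr_fun h (x, y))
    simp only [block_apply] at hx hy
    refine ⟨?_, ?_, ?_, ?_⟩ <;> ext x
    · simpa using hx x 0
    · simpa using hx 0 x
    · simpa using hy x 0
    · simpa using hy 0 x
  · rintro ⟨rfl, rfl, rfl, rfl⟩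
    rfl

theorem block_eq_zero_iff {a b c d : Module.End ℝ S₀} :
    block a b c d = 0 ↔ a = 0 ∧ b = 0 ∧ c = 0 ∧ d = 0 := by
  have hzero : block (0 : Module.End ℝ S₀) 0 0 0 = 0 := by
    exact LinearMap.ext fun x => by simp [block_apply]
  rw [← hzero, block_inj]

variable (S₀) in
theorem exists_linearMap_block : ∃ a b c d : Module.End ℝ (S₀ × S₀) →ₗ[ℝ] Module.End ℝ S₀,
    ∀ X, X = block (a X) (b X) (c X) (d X) := by
  let corner (π : S₀ × S₀ →ₗ[ℝ] S₀) (ι : S₀ →ₗ[ℝ] S₀ × S₀) :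
      Module.End ℝ (S₀ × S₀) →ₗ[ℝ] Module.End ℝ S₀ :=
    LinearMap.lcomp ℝ S₀ ι ∘ₗ LinearMap.llcomp ℝ _ _ _ π
  refine ⟨corner (.fst ..) (.inl ..), corner (.fst ..) (.inr ..), corner (.snd ..) (.inl ..),
    corner (.snd ..) (.inr ..), fun X => ?_⟩
  refine LinearMap.ext fun x => ?_
  have hx : x = LinearMap.inl ℝ S₀ S₀ x.1 + LinearMap.inr ℝ S₀ S₀ x.2 := by simp
  conv_lhs => rw [hx, map_add]
  rfl

theorem rhoSpin_wedge {E : Type*} [NormedAddCommGroup E] [InnerProductSpace ℝ E]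
    [Module (ClE E) S₀] [IsScalarTower ℝ (ClE E) S₀] (e : E) :
    rhoSpin S₀ (wedge vecP (vecE e)) = block 0 (√2 • clMul S₀ e) 0 0 := by
  rw [wedge, map_smul, map_sub, map_mul, map_mul, rhoSpin, CliffordAlgebra.lift_ι_apply,
    CliffordAlgebra.lift_ι_apply]
  change (1 / 4 : ℝ) • (block _ _ _ _ * block _ _ _ _ - block _ _ _ _ * block _ _ _ _) = _
  rw [block_mul, block_mul, block_sub, smul_block, block_inj]
  simp only [vecP, vecE, map_zero, neg_zero, mul_zero, zero_smul, zero_mul, add_zero, zero_add,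
    mul_one, sub_self, smul_zero, true_and, and_true, smul_mul_assoc, one_mul, mul_smul_comm,
    mul_neg]
  module

end Blocks

section Representations

variable {E : Type*} [NormedAddCommGroup E] [InnerProductSpace ℝ E]
variable {S₀ : Type*} [AddCommGroup S₀] [Module ℝ S₀] [Module (ClE E) S₀]
  [IsScalarTower ℝ (ClE E) S₀]

/-- The relations between the blocks which make `ρ(e^♭) = √2 (0 Be; 0 0)`,
`ρ(e) = (a(e) r(e); 0 d(e))` and `ρ(p) = √2 (0 Z; 0 0)` a representation of `𝔥𝔢𝔦𝔰_b`. -/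
structure IsBlockData (a d r : E →ₗ[ℝ] Module.End ℝ S₀) (Z : Module.End ℝ S₀) : Prop where
  clMul_mul_sub : ∀ e f, clMul S₀ e * d f - a f * clMul S₀ e = (inner ℝ e f : ℝ) • Z
  commute_upper : ∀ e f, Commute (a e) (a f)
  commute_lower : ∀ e f, Commute (d e) (d f)
  charge_mul : ∀ e, Z * d e = a e * Z
  suitable : Suitable a d r

variable [FiniteDimensional ℝ E] {b : LinearMap.BilinForm ℝ E}

theorem bilin_eq_inner_opB (e f : E) : b e f = inner ℝ (opB b e) f := by
  rw [opB_spec, pairing_apply, neg_neg]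

theorem opB_surjective (hb : b.Nondegenerate) : Function.Surjective (opB b) := by
  rw [← LinearMap.injective_iff_surjective, ← LinearMap.ker_eq_bot, LinearMap.ker_eq_bot']
  intro e he
  refine hb.1 e fun f => ?_
  rw [bilin_eq_inner_opB, he, inner_zero_left]

namespace Heis

/-- The inclusion of `E` in `𝔥𝔢𝔦𝔰_b` as a linear map. -/
def ofVecLinear (b : LinearMap.BilinForm ℝ E) : E →ₗ[ℝ] Heis b where
  toFun := ofVec b
  map_add' e f := by ext <;> simp [ofVec]
  map_smul' r e := by ext <;> simp [ofVec]

theorem lie_ofFlat_ofVec (e f : E) : ⁅ofFlat b e, ofVec b f⁆ = b e f • p b := by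
  ext <;> simp [ofFlat, ofVec, p]

theorem lie_ofVec_ofVec (e f : E) : ⁅ofVec b e, ofVec b f⁆ = 0 := by
  ext <;> simp [ofVec]

theorem lie_p_ofVec (e : E) : ⁅p b, ofVec b e⁆ = 0 := by
  ext <;> simp [p, ofVec]

end Heis

namespace IsSpin

variable {ρ : Heis b →ₗ⁅ℝ⁆ Module.End ℝ (S₀ × S₀)}

theorem lie_ofVec (hρ : IsSpin ρ) (hb : b.Nondegenerate) {f : E}
    {a r q d p₁₁ p₁₂ p₂₁ p₂₂ : Module.End ℝ S₀} (hf : ρ (Heis.ofVec b f) = block a r q d)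
    (hp : ρ (Heis.p b) = block p₁₁ p₁₂ p₂₁ p₂₂) (e : E) :
    √2 • (clMul S₀ e * q) = (inner ℝ e f : ℝ) • p₁₁ ∧
    √2 • (clMul S₀ e * d - a * clMul S₀ e) = (inner ℝ e f : ℝ) • p₁₂ ∧
    0 = (inner ℝ e f : ℝ) • p₂₁ ∧ -(√2 • (q * clMul S₀ e)) = (inner ℝ e f : ℝ) • p₂₂ := by
  obtain ⟨e, rfl⟩ := opB_surjective hb e
  have h := congrArg ρ (Heis.lie_ofFlat_ofVec (b := b) e f)
  rw [LieHom.map_lie, map_smul, hρ e, rhoSpin_wedge, hf, hp, Ring.lie_def, block_mul,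
    block_mul, block_sub, smul_block, block_inj, bilin_eq_inner_opB] at h
  simpa [smul_sub] using h

theorem lowerLeft_eq_zero (hρ : IsSpin ρ) (hb : b.Nondegenerate) (hE : 2 ≤ Module.finrank ℝ E)
    {f : E} {a r q d : Module.End ℝ S₀} (hf : ρ (Heis.ofVec b f) = block a r q d) : q = 0 := by
  obtain ⟨_, _, _, _, hX⟩ := exists_linearMap_block S₀
  obtain ⟨e, he, hef⟩ := exists_ne_zero_orthogonal {f} (by rw [Finset.card_singleton]; lia)
  have h := (hρ.lie_ofVec hb hf (hX _) e).1
  rw [hef f (Finset.mem_singleton_self f), zero_smul,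
    smul_eq_zero_iff_right (Real.sqrt_ne_zero'.mpr two_pos)] at h
  have hq : (inner ℝ e e : ℝ) • q = 0 := by
    rw [← one_mul q, ← smul_mul_assoc, ← clMul_mul_self, mul_assoc, h, mul_zero]
  exact (smul_eq_zero_iff_right (inner_self_ne_zero.mpr he)).mp hq

theorem exists_isBlockData (hρ : IsSpin ρ) (hb : b.Nondegenerate)
    (hE : 2 ≤ Module.finrank ℝ E) :
    ∃ (a d r : E →ₗ[ℝ] Module.End ℝ S₀) (Z : Module.End ℝ S₀), IsBlockData a d r Z ∧
      ρ (Heis.p b) = √2 • block 0 Z 0 0 ∧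
      ∀ e, ρ (Heis.ofVec b e) = block (a e) (r e) 0 (d e) := by
  have h2 : √2 ≠ 0 := Real.sqrt_ne_zero'.mpr two_pos
  obtain ⟨a, r, q, d, hX⟩ := exists_linearMap_block S₀
  let v := ρ.toLinearMap ∘ₗ Heis.ofVecLinear b
  have hv (e : E) : ρ (Heis.ofVec b e) = block (a (v e)) (r (v e)) 0 (d (v e)) := by
    rw [← hρ.lowerLeft_eq_zero hb hE (hX (ρ (Heis.ofVec b e)))]
    exact hX _
  have hrel (e f : E) := hρ.lie_ofVec hb (hv f) (hX (ρ (Heis.p b))) e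
  obtain ⟨Z, hp⟩ : ∃ Z, ρ (Heis.p b) = √2 • block 0 Z 0 0 := by
    have : Nontrivial E := Module.nontrivial_of_finrank_pos (R := ℝ) (by lia)
    obtain ⟨e, he⟩ := exists_ne (0 : E)
    have hee : (inner ℝ e e : ℝ) ≠ 0 := inner_self_ne_zero.mpr he
    obtain ⟨h₁₁, -, h₂₁, h₂₂⟩ := hrel e e
    rw [mul_zero, smul_zero, eq_comm, smul_eq_zero_iff_right hee] at h₁₁
    rw [eq_comm, smul_eq_zero_iff_right hee] at h₂₁
    rw [zero_mul, smul_zero, neg_zero, eq_comm, smul_eq_zero_iff_right hee] at h₂₂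
    refine ⟨(√2)⁻¹ • r (ρ (Heis.p b)), (hX _).trans ?_⟩
    rw [h₁₁, h₂₁, h₂₂, smul_block, smul_inv_smul₀ h2, smul_zero]
  have hvec (e f : E) := congrArg ρ (Heis.lie_ofVec_ofVec (b := b) e f)
  have hctr (e : E) := congrArg ρ (Heis.lie_p_ofVec (b := b) e)
  simp only [LieHom.map_lie, map_zero, hv, hp, Ring.lie_def, smul_block, block_mul, block_sub,
    block_eq_zero_iff, mul_zero, add_zero, zero_mul, zero_add, smul_zero] at hvec hctr
  refine ⟨a ∘ₗ v, d ∘ₗ v, r ∘ₗ v, Z, ⟨fun e f => ?_, fun e f => sub_eq_zero.mp (hvec e f).1,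
    fun e f => sub_eq_zero.mp (hvec e f).2.2.2, fun e => ?_, fun e f => ?_⟩, hp, hv⟩
  · have h := (hρ.lie_ofVec hb (hv f) (hp.trans (smul_block ..)) e).2.1
    rw [smul_comm] at h
    exact smul_right_injective _ h2 h
  · have h := (hctr e).2.1
    rw [smul_mul_assoc, mul_smul_comm, ← smul_sub, smul_eq_zero_iff_right h2] at h
    exact sub_eq_zero.mp h
  · linear_combination (norm := (simp only [LinearMap.comp_apply]; abel)) (hvec e f).2.1

end IsSpin

variable (b) in
/-- The spin representation of the Heisenberg algebra with given blocks. -/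
def blockRep {a d r : E →ₗ[ℝ] Module.End ℝ S₀} {Z : Module.End ℝ S₀}
    (h : IsBlockData a d r Z) : Heis b →ₗ⁅ℝ⁆ Module.End ℝ (S₀ × S₀) where
  toFun x := block (a x.vec)
    (√2 • clMul S₀ (opB b (flat.symm x.dual)) + r x.vec + (x.ctr * √2) • Z) 0 (d x.vec)
  map_add' x y := by
    rw [block_add, block_inj]
    refine ⟨by simp, ?_, by simp, by simp⟩
    simp only [Heis.dual_add, Heis.vec_add, Heis.ctr_add, map_add, smul_add, add_mul, add_smul]
    abel
  map_smul' t x := by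
    rw [RingHom.id_apply, smul_block, block_inj]
    refine ⟨by simp, ?_, by simp, by simp⟩
    simp only [Heis.dual_smul, Heis.vec_smul, Heis.ctr_smul, map_smul]
    module
  map_lie' := by
    intro x y
    rw [Ring.lie_def, block_mul, block_mul, block_sub, block_inj]
    refine ⟨by simp [(h.commute_upper x.vec y.vec).eq], ?_, by simp,
      by simp [(h.commute_lower x.vec y.vec).eq]⟩
    have hx := h.clMul_mul_sub (opB b (flat.symm x.dual)) y.vec
    have hy := h.clMul_mul_sub (opB b (flat.symm y.dual)) x.vec
    rw [← bilin_eq_inner_opB] at hx hy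
    simp only [Heis.dual_lie, Heis.vec_lie, Heis.ctr_lie, map_zero, smul_zero, zero_add, mul_add,
      add_mul, mul_smul_comm, smul_mul_assoc, h.charge_mul]
    rw [sub_mul, sub_smul, mul_comm (b _ _), mul_comm (b _ _), mul_smul, mul_smul, ← hx, ← hy]
    linear_combination (norm := module) -h.suitable x.vec y.vec

section BlockRep

variable {a d r : E →ₗ[ℝ] Module.End ℝ S₀} {Z : Module.End ℝ S₀} (h : IsBlockData a d r Z)

theorem blockRep_apply (x : Heis b) : blockRep b h x = block (a x.vec)
    (√2 • clMul S₀ (opB b (flat.symm x.dual)) + r x.vec + (x.ctr * √2) • Z) 0 (d x.vec) := rfl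

theorem isSpin_blockRep : IsSpin (blockRep b h) := fun e => by
  simp [rhoSpin_wedge, blockRep_apply, Heis.ofFlat]

theorem blockRep_p : blockRep b h (Heis.p b) = √2 • block 0 Z 0 0 := by
  simp [blockRep_apply, Heis.p, smul_block]

theorem blockRep_ofVec (e : E) :
    blockRep b h (Heis.ofVec b e) = block (a e) (r e) 0 (d e) := by
  simp [blockRep_apply, Heis.ofVec]

end BlockRep

end Representations

section Classification

variable {E : Type*} [NormedAddCommGroup E] [InnerProductSpace ℝ E]
variable {S₀ : Type*} [AddCommGroup S₀] [Module ℝ S₀] [Module (ClE E) S₀]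
  [IsScalarTower ℝ (ClE E) S₀]
variable {Q : ℍ[ℝ] →ₐ[ℝ] Module.End ℝ S₀} {W : Module.End ℝ S₀}

theorem smul_block_cx_ne_zero_iff [Nontrivial S₀] [Nontrivial E]
    (H : IsQuaternionicClifford Q (clMul S₀ : E →ₗ[ℝ] Module.End ℝ S₀) W) {h₁ h₂ : ℍ[ℝ]} :
    √2 • block 0 (cx Q W h₁ h₂) 0 0 ≠ 0 ↔ h₁ ≠ 0 ∨ h₂ ≠ 0 := by
  rw [smul_ne_zero_iff_right (Real.sqrt_ne_zero'.mpr two_pos), Ne, block_eq_zero_iff,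
    H.cx_eq_zero_iff]
  tauto

theorem isBlockData_diag_iff [Nontrivial S₀] (hE : 3 ≤ Module.finrank ℝ E)
    (H : IsQuaternionicClifford Q (clMul S₀ : E →ₗ[ℝ] Module.End ℝ S₀) W) {h₁ h₂ : ℍ[ℝ]}
    {h₃ h₄ : E →ₗ[ℝ] ℍ[ℝ]} {r : E →ₗ[ℝ] Module.End ℝ S₀} :
    IsBlockData (diagUpper Q (clMul S₀) W h₁ h₂ h₃ h₄) (diagLower Q (clMul S₀) W h₁ h₂ h₃ h₄) r
        (cx Q W h₁ h₂) ↔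
      IsQuaternionSolution h₁ h₂ h₃ h₄ ∧
        Suitable (diagUpper Q (clMul S₀) W h₁ h₂ h₃ h₄)
          (diagLower Q (clMul S₀) W h₁ h₂ h₃ h₄) r := by
  have : Nontrivial E := Module.nontrivial_of_finrank_pos (R := ℝ) (by lia)
  exact ⟨fun h => ⟨H.isQuaternionSolution_of_commute hE h.commute_upper, h.suitable⟩,
    fun ⟨hs, hsuit⟩ => ⟨H.vec_mul_diagLower_sub h₁ h₂ h₃ h₄, H.commute_diagUpper hs,
      H.commute_diagLower hs, H.cx_mul_diagLower hs, hsuit⟩⟩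

variable {m : ℕ} [FiniteDimensional ℝ E] {b : LinearMap.BilinForm ℝ E} [Nontrivial S₀]
  (Φ : ℍ[ℝ] ≃ₐ[ℝ] evenSchur E S₀)

theorem IsSpin.exists_isParameter (hm : m ≡ 6 [MOD 8]) (ε : OrthonormalBasis (Fin m) ℝ E)
    (hb : b.Nondegenerate) {ρ : Heis b →ₗ⁅ℝ⁆ Module.End ℝ (S₀ × S₀)} (hρ : IsSpin ρ)
    (hcharge : ρ (Heis.p b) ≠ 0) :
    ∃ (h₁ h₂ : ℍ[ℝ]) (h₃ h₄ : E →ₗ[ℝ] ℍ[ℝ]) (ρ₁₂ : E →ₗ[ℝ] Module.End ℝ S₀),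
      IsParameter h₁ h₂ h₃ h₄ ∧
      Suitable (rho11 Φ (volumeForm ε) h₁ h₂ h₃ h₄) (rho22 Φ (volumeForm ε) h₁ h₂ h₃ h₄) ρ₁₂ ∧
      IsGivenBy ρ Φ (volumeForm ε) h₁ h₂ h₃ h₄ ρ₁₂ := by
  have hE := six_le_finrank hm ε
  have : Nontrivial E := Module.nontrivial_of_finrank_pos (R := ℝ) (by lia)
  have H := isQuaternionicClifford hm ε Φ
  obtain ⟨a, d, ρ₁₂, Z, hdata, hp, hvec⟩ := hρ.exists_isBlockData hb (by lia)
  obtain ⟨h₁, h₂, h₃, h₄, rfl, rfl, rfl⟩ := H.exists_eq_diag hdata.clMul_mul_sub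
  obtain ⟨hsol, hsuit⟩ := (isBlockData_diag_iff (by lia) H).mp hdata
  rw [hp, smul_block_cx_ne_zero_iff H] at hcharge
  exact ⟨h₁, h₂, h₃, h₄, ρ₁₂, isParameter_iff.mpr ⟨hsol, hcharge⟩, hsuit, hp, hvec⟩

variable (b) in
theorem IsParameter.exists_isSpin (hm : m ≡ 6 [MOD 8]) (ε : OrthonormalBasis (Fin m) ℝ E)
    {h₁ h₂ : ℍ[ℝ]} {h₃ h₄ : E →ₗ[ℝ] ℍ[ℝ]} {ρ₁₂ : E →ₗ[ℝ] Module.End ℝ S₀}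
    (hpar : IsParameter h₁ h₂ h₃ h₄)
    (hsuit : Suitable (rho11 Φ (volumeForm ε) h₁ h₂ h₃ h₄)
      (rho22 Φ (volumeForm ε) h₁ h₂ h₃ h₄) ρ₁₂) :
    ∃ ρ : Heis b →ₗ⁅ℝ⁆ Module.End ℝ (S₀ × S₀), IsSpin ρ ∧ ρ (Heis.p b) ≠ 0 ∧
      IsGivenBy ρ Φ (volumeForm ε) h₁ h₂ h₃ h₄ ρ₁₂ := by
  have hE := six_le_finrank hm ε
  have : Nontrivial E := Module.nontrivial_of_finrank_pos (R := ℝ) (by lia)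
  have H := isQuaternionicClifford hm ε Φ
  obtain ⟨hsol, hne⟩ := isParameter_iff.mp hpar
  have hdata := (isBlockData_diag_iff (by lia) H).mpr ⟨hsol, hsuit⟩
  refine ⟨blockRep b hdata, isSpin_blockRep hdata, ?_, blockRep_p hdata, blockRep_ofVec hdata⟩
  rwa [blockRep_p, smul_block_cx_ne_zero_iff H]

end Classification

end SpinHeis

end

open SpinHeis in
theorem theorem2p17_general {m : ℕ} (hm : m ≡ 6 [MOD 8])
    {E : Type*} [NormedAddCommGroup E] [InnerProductSpace ℝ E] [FiniteDimensional ℝ E]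
    (ε : OrthonormalBasis (Fin m) ℝ E)
    (b : LinearMap.BilinForm ℝ E) (hnondeg : b.Nondegenerate)
    {S₀ : Type*} [AddCommGroup S₀] [Module ℝ S₀] [Module (ClE E) S₀]
    [IsScalarTower ℝ (ClE E) S₀] [IsSimpleModule (ClE E) S₀] :
    Nonempty (ℍ[ℝ] ≃ₐ[ℝ] evenSchur E S₀) ∧
    ∀ Φ : ℍ[ℝ] ≃ₐ[ℝ] evenSchur E S₀,
      (∀ ρ : Heis b →ₗ⁅ℝ⁆ Module.End ℝ (S₀ × S₀), IsSpin ρ → ρ (Heis.p b) ≠ 0 →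
        ∃ (h₁ h₂ : ℍ[ℝ]) (h₃ h₄ : E →ₗ[ℝ] ℍ[ℝ]) (ρ₁₂ : E →ₗ[ℝ] Module.End ℝ S₀),
          IsParameter h₁ h₂ h₃ h₄ ∧
          Suitable (rho11 Φ (volumeForm ε) h₁ h₂ h₃ h₄) (rho22 Φ (volumeForm ε) h₁ h₂ h₃ h₄) ρ₁₂ ∧
          IsGivenBy ρ Φ (volumeForm ε) h₁ h₂ h₃ h₄ ρ₁₂) ∧
      (∀ (h₁ h₂ : ℍ[ℝ]) (h₃ h₄ : E →ₗ[ℝ] ℍ[ℝ]) (ρ₁₂ : E →ₗ[ℝ] Module.End ℝ S₀),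
          IsParameter h₁ h₂ h₃ h₄ →
          Suitable (rho11 Φ (volumeForm ε) h₁ h₂ h₃ h₄) (rho22 Φ (volumeForm ε) h₁ h₂ h₃ h₄) ρ₁₂ →
        ∃ ρ : Heis b →ₗ⁅ℝ⁆ Module.End ℝ (S₀ × S₀), IsSpin ρ ∧ ρ (Heis.p b) ≠ 0 ∧
          IsGivenBy ρ Φ (volumeForm ε) h₁ h₂ h₃ h₄ ρ₁₂) := by
  refine ⟨nonempty_quaternion_algEquiv_evenSchur hm ε, fun Φ => ?_⟩
  have : Nontrivial S₀ := IsSimpleModule.nontrivial (ClE E) S₀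
  exact ⟨fun ρ hρ hcharge => hρ.exists_isParameter Φ hm ε hnondeg hcharge,
    fun h₁ h₂ h₃ h₄ ρ₁₂ hpar hsuit => hpar.exists_isSpin b Φ hm ε hsuit⟩

open SpinHeis in
theorem theorem2p17 {m : ℕ} (hm : m ≡ 6 [MOD 8])
    {E : Type*} [NormedAddCommGroup E] [InnerProductSpace ℝ E] [FiniteDimensional ℝ E]
    (ε : OrthonormalBasis (Fin m) ℝ E)
    (b : LinearMap.BilinForm ℝ E) (hsymm : b.IsSymm) (hnondeg : b.Nondegenerate)
    {S₀ : Type*} [AddCommGroup S₀] [Module ℝ S₀] [Module (ClE E) S₀]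
    [IsScalarTower ℝ (ClE E) S₀] [IsSimpleModule (ClE E) S₀] :
    Nonempty (ℍ[ℝ] ≃ₐ[ℝ] evenSchur E S₀) ∧
    ∀ Φ : ℍ[ℝ] ≃ₐ[ℝ] evenSchur E S₀,
      (∀ ρ : Heis b →ₗ⁅ℝ⁆ Module.End ℝ (S₀ × S₀), IsSpin ρ → ρ (Heis.p b) ≠ 0 →
        ∃ (h₁ h₂ : ℍ[ℝ]) (h₃ h₄ : E →ₗ[ℝ] ℍ[ℝ]) (ρ₁₂ : E →ₗ[ℝ] Module.End ℝ S₀),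
          IsParameter h₁ h₂ h₃ h₄ ∧
          Suitable (rho11 Φ (volumeForm ε) h₁ h₂ h₃ h₄) (rho22 Φ (volumeForm ε) h₁ h₂ h₃ h₄) ρ₁₂ ∧
          IsGivenBy ρ Φ (volumeForm ε) h₁ h₂ h₃ h₄ ρ₁₂) ∧
      (∀ (h₁ h₂ : ℍ[ℝ]) (h₃ h₄ : E →ₗ[ℝ] ℍ[ℝ]) (ρ₁₂ : E →ₗ[ℝ] Module.End ℝ S₀),
          IsParameter h₁ h₂ h₃ h₄ →
          Suitable (rho11 Φ (volumeForm ε) h₁ h₂ h₃ h₄) (rho22 Φ (volumeForm ε) h₁ h₂ h₃ h₄) ρ₁₂ →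
        ∃ ρ : Heis b →ₗ⁅ℝ⁆ Module.End ℝ (S₀ × S₀), IsSpin ρ ∧ ρ (Heis.p b) ≠ 0 ∧
          IsGivenBy ρ Φ (volumeForm ε) h₁ h₂ h₃ h₄ ρ₁₂) := by
  exact theorem2p17_general hm ε b hnondeg
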